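/- Let $n\ge 1$ be an integer, $\lambda\in(0,1]$ and $\bar\epsilon\in[0,1)$. Time is slotted into channel uses $0,1,2,\dots$, grouped into consecutive frames of $n$ channel uses. In each channel use, an information packet arrives with probability $\lambda$. A transmitter with system capacity $1$, initially empty, works as follows (last-come first-serve with preemption in service, simple ARQ). A packet that arrives during frame $\tau$ discards any packet already in the system, receives the time stamp $\tau$, and is transmitted in frames $\tau+1,\tau+2,\dots$, once per frame, until it is decoded or discarded. A transmission in a frame fails with probability $\bar\epsilon$, and its outcome is known at the end of that frame (so a packet decoded in the frame in which a newer packet arrives counts as delivered). All arrivals and transmission failures are mutually independent. Times below are measured in frames, and of several packets arriving in the same frame only the last one counts. Let $T_m$ and $D_m$ be the time stamp and the service time (number of transmissions, including the successful one) of the $m$th delivered packet, so that it is received at time $T_m+D_m$. The age of information at time $t$ is $t-T_{\widehat m(t)}$, where $\widehat m(t)$ is the index of the most recently received packet, and the peak age $A_m$ is the age just before the $m$th delivered packet is received, i.e. with that reception not yet counted in $\widehat m(t)$. Put $$p=\frac{1-\bar\epsilon}{1-\bar\epsilon(1-\lambda)^n},\qquad G_{H^{(0)}}(s)=\frac{[1-\bar\epsilon(1-\lambda)^n]\,s}{1-\bar\epsilon(1-\lambda)^n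 s},$$ $$G_T(s)=\frac{[1-(1-\lambda)^n]\,s}{1-(1-\lambda)^n s},\qquad G_{T^{(0)}}(s)=\frac{G_T(s)-(1-p)\,G_{H^{(0)}}(s)}{p}.$$ Then $A_m$ converges in distribution, as $m\to\infty$, to a random variable $A$ (the steady-state peak age of information) whose probability generating function $G_A(s)=\mathbb E[s^A]$ is, for all complex $s$ with $|s|\le 1$, $$G_A(s)=G_{T^{(0)}}(s)\,\frac{p\,G_{H^{(0)}}(s)}{1-(1-p)\,G_{H^{(0)}}(s)}.$$ Moreover, for every arriving packet: $p$ is the probability that it is not preempted; and, for all complex $s$ with $|s|\le 1$, $G_{H^{(0)}}$ is the probability generating function of its service time given that it is not preempted, $G_T$ is that of the time $T$ between its arrival and the arrival of the next packet, and $G_{T^{(0)}}$ is that of $T$ given that the first of the two packets is delivered (not preempted). -/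

import Mathlib

open MeasureTheory ProbabilityTheory Filter

/-! A discrete-time link. Channel uses are numbered `0, 1, 2, …`; frame `t` consists of the `n`
channel uses `t * n, …, t * n + n - 1`. A sample path is described by
* `a : ℕ → Bool`, where `a c = true` when an information packet reaches the transmitter in
  channel use `c`;
* `e : ℕ → Bool`, where `e t = true` when a coded packet sent in frame `t` is not decoded (NACK).
-/

namespace PeakAge

section Path

variable (n : ℕ) (a e : ℕ → Bool)

/-- At least one information packet arrives during frame `t`. -/
def FrameArrival (t : ℕ) : Prop := ∃ i, i < n ∧ a (t * n + i) = true

open Classical in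
/-- Content of the capacity-one system at the start of frame `t`: `none` when it is empty,
`some τ` when it holds a packet with time stamp `τ`, the frame in which that packet entered.
A stored packet is sent in each frame. A packet arriving during frame `t` discards whatever is
stored (the packet in service, or an earlier arrival of the same frame) and is sent from frame
`t + 1` on; otherwise the stored packet is removed after an ACK and kept after a NACK. -/
noncomputable def queue : ℕ → Option ℕ
  | 0 => none
  | t + 1 =>
    if FrameArrival n a t then some t
    else if e t = true then queue t
    else none

/-- The packet with time stamp `τ` is decoded in frame `t`. -/
def DeliveredAt (τ t : ℕ) : Prop := queue n a e t = some τ ∧ e t = false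

/-- Some packet is decoded in frame `t`. -/
def Delivery (t : ℕ) : Prop := ∃ τ, DeliveredAt n a e τ t

/-- The packet with time stamp `τ` is decoded at some time, that is, it is not preempted. -/
def Delivered (τ : ℕ) : Prop := ∃ t, DeliveredAt n a e τ t

/-- Service time, in frames, of the packet with time stamp `τ`: the number of transmissions (in
frames `τ + 1, τ + 2, …`) up to and including the successful one. It is meaningful only for
packets that are not preempted. -/
noncomputable def service (τ : ℕ) : ℕ := sInf {d | DeliveredAt n a e τ (τ + d)}

/-- Time stamp of the `j`th packet (counted from `0`) that enters the system and is not superseded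
in its own frame: the `j`th frame with an arrival. -/
noncomputable def arrivalStamp (j : ℕ) : ℕ := Nat.nth (FrameArrival n a) j

/-- Number of frames between the arrivals of the `j`th and the `(j+1)`st packet. -/
noncomputable def interarrival (j : ℕ) : ℕ := arrivalStamp n a (j + 1) - arrivalStamp n a j

/-- Time stamp `T_m` of the `m`th delivered packet (counted from `0`). -/
noncomputable def stamp (m : ℕ) : ℕ := (queue n a e (Nat.nth (Delivery n a e) m)).getD 0

/-- Service time `D_m` of the `m`th delivered packet. -/
noncomputable def stampService (m : ℕ) : ℕ := service n a e (stamp n a e m)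

/-- Index of the most recent packet that the destination has received before the receptions of
time `t`: the largest `m` with `T_m + D_m < t`. -/
noncomputable def lastBefore (t : ℕ) : ℕ :=
  sSup {m | stamp n a e m + stampService n a e m < t}

/-- Age of information at time `t`, just before a packet received at time `t` is counted. -/
noncomputable def ageBefore (t : ℕ) : ℕ := t - stamp n a e (lastBefore n a e t)

/-- Peak age `A_m`: the age just before the `m`th delivered packet is received, which happens at
time `T_m + D_m`. (For the very first delivered packet, `m = 0`, there is no earlier one, and the
value is a convention.) -/
noncomputable def peakAge (m : ℕ) : ℕ := ageBefore n a e (stamp n a e m + stampService n a e m)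

end Path

/-- Probability generating function `E[s ^ X]`. -/
noncomputable def pgf {Ω : Type*} [MeasurableSpace Ω] (P : Measure Ω) (X : Ω → ℕ) (s : ℂ) : ℂ :=
  ∫ ω, s ^ X ω ∂P

/-- `p = (1 - ε) / (1 - ε (1 - λ)^n)`. -/
noncomputable def probOK (n : ℕ) (lam eps : ℝ) : ℝ := (1 - eps) / (1 - eps * (1 - lam) ^ n)

/-- `G_{H⁰}(s) = [1 - ε (1 - λ)^n] s / (1 - ε (1 - λ)^n s)`. -/
noncomputable def GH0 (n : ℕ) (lam eps : ℝ) (s : ℂ) : ℂ :=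
  (1 - (eps : ℂ) * (1 - (lam : ℂ)) ^ n) * s / (1 - (eps : ℂ) * (1 - (lam : ℂ)) ^ n * s)

/-- `G_T(s) = [1 - (1 - λ)^n] s / (1 - (1 - λ)^n s)`. -/
noncomputable def GT (n : ℕ) (lam : ℝ) (s : ℂ) : ℂ :=
  (1 - (1 - (lam : ℂ)) ^ n) * s / (1 - (1 - (lam : ℂ)) ^ n * s)

/-- `G_{T⁰}(s) = [G_T(s) - (1 - p) G_{H⁰}(s)] / p`. -/
noncomputable def GT0 (n : ℕ) (lam eps : ℝ) (s : ℂ) : ℂ :=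
  (GT n lam s - (1 - (probOK n lam eps : ℂ)) * GH0 n lam eps s) / (probOK n lam eps : ℂ)

end PeakAge

/-! Only two bits per frame matter: whether some packet arrives, and whether a transmission fails.
Pairs belonging to different frames are independent, with P(no arrival) = r = (1 - λ)^n and P(NACK)
= ε, and within a frame the two bits are independent.

Let the `m`th delivered packet have stamp `u`, let `v` be the next frame with an arrival, and let
`t` be the first frame after `v` with an ACK. From `v` on the system stays occupied until `t`,
because a preemption replaces the stored packet without emptying the system. Hence the next delivery
takes place at `t`, whichever packet is then stored, and the peak age is t - u = (v - u) + (t - v)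
(`PeakEvent.nth_eq`, `PeakEvent.peakAge_eq`). The first summand is an interarrival time, restricted
to the event that the packet of frame `u` is delivered, that is, that an ACK occurs in frames u+1,
…, v. The second is geometric with success probability 1 - ε and is independent of everything up to
`v`. Its generating function (1 - ε)s / (1 - εs) is the factor pG / (1 - (1 - p)G), with G the
generating function of the service time.

To make this rigorous, the sample space is split according to `u` and the marks
(`setIntegral_of_renewal`). Each piece is an event known at the end of frame `u`, followed by a
pattern in later frames whose probability does not depend on `u` (`measureReal_run_then`,
`prob_ackedEvent`). The sum over `u` therefore factors out as a constant, which is found by taking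
the test function 1: it is 1 for the `j`th arrival and 1/p for peak ages. The result does not depend
on `m`, so all peak ages from index 1 on have the same law and the convergence is eventual equality.
-/

namespace PeakAge

/-! ### Deterministic analysis of a sample path -/

section PathLemmas

variable {n : ℕ} {a e : ℕ → Bool}

lemma queue_succ (t : ℕ) [Decidable (FrameArrival n a t)] : queue n a e (t + 1) =
    if FrameArrival n a t then some t else if e t = true then queue n a e t else none := by
  rw [queue]
  congr

lemma queue_eq_some_iff {t u : ℕ} : queue n a e t = some u ↔
    u < t ∧ FrameArrival n a u ∧ ∀ i, u < i → i < t → ¬ FrameArrival n a i ∧ e i = true := by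
  classical
  induction t with
  | zero => simp [queue]
  | succ t ih =>
    rw [queue_succ]
    by_cases hp : FrameArrival n a t
    · rw [if_pos hp]
      constructor
      · intro h
        obtain rfl : t = u := by simpa using h
        exact ⟨by omega, hp, fun i h1 h2 => by omega⟩
      · rintro ⟨h1, -, h3⟩
        by_cases h : u = t
        · rw [h]
        · exact absurd hp (h3 t (by omega) (by omega)).1
    · rw [if_neg hp]
      by_cases he : e t = true
      · rw [if_pos he, ih]
        constructor
        · rintro ⟨h1, h2, h3⟩
          refine ⟨by omega, h2, fun i hi hi' => ?_⟩
          by_cases h : i = t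
          · rw [h]; exact ⟨hp, he⟩
          · exact h3 i hi (by omega)
        · rintro ⟨h1, h2, h3⟩
          have : u ≠ t := by rintro rfl; exact hp h2
          exact ⟨by omega, h2, fun i hi hi' => h3 i hi (by omega)⟩
      · rw [if_neg he]
        simp only [reduceCtorEq, false_iff]
        rintro ⟨h1, h2, h3⟩
        have : u ≠ t := by rintro rfl; exact hp h2
        exact he (h3 t (by omega) (by omega)).2

/-- Occupancy ignores preemption: in contrast with `queue_eq_some_iff`, further arrivals between `u`
and `t` are allowed. This is what makes delivery times depend only on the first ACK after an
arrival. -/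
lemma queue_ne_none_iff {t : ℕ} : queue n a e t ≠ none ↔
    ∃ u, u < t ∧ FrameArrival n a u ∧ ∀ i, u < i → i < t → e i = true := by
  classical
  induction t with
  | zero => simp [queue]
  | succ t ih =>
    rw [queue_succ]
    by_cases hp : FrameArrival n a t
    · rw [if_pos hp]
      simp only [ne_eq, reduceCtorEq, not_false_eq_true, true_iff]
      exact ⟨t, by omega, hp, fun i h1 h2 => by omega⟩
    · rw [if_neg hp]
      by_cases he : e t = true
      · rw [if_pos he, ih]
        constructor
        · rintro ⟨u, h1, h2, h3⟩
          refine ⟨u, by omega, h2, fun i hi hi' => ?_⟩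
          by_cases h : i = t
          · rw [h]; exact he
          · exact h3 i hi (by omega)
        · rintro ⟨u, h1, h2, h3⟩
          have : u ≠ t := by rintro rfl; exact hp h2
          exact ⟨u, by omega, h2, fun i hi hi' => h3 i hi (by omega)⟩
      · rw [if_neg he]
        simp only [ne_eq, not_true_eq_false, false_iff]
        rintro ⟨u, h1, h2, h3⟩
        have : u ≠ t := by rintro rfl; exact hp h2
        exact he (h3 t (by omega) (by omega))

lemma delivery_iff {t : ℕ} : Delivery n a e t ↔ e t = false ∧
    ∃ u, u < t ∧ FrameArrival n a u ∧ ∀ i, u < i → i < t → e i = true := by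
  rw [← queue_ne_none_iff, Option.ne_none_iff_exists']
  simp [Delivery, DeliveredAt, and_comm]

lemma deliveredAt_iff {u t : ℕ} : DeliveredAt n a e u t ↔ (u < t ∧ FrameArrival n a u ∧
    ∀ i, u < i → i < t → ¬ FrameArrival n a i ∧ e i = true) ∧ e t = false := by
  rw [DeliveredAt, queue_eq_some_iff]

lemma DeliveredAt.unique {u t t' : ℕ} (h : DeliveredAt n a e u t) (h' : DeliveredAt n a e u t') :
    t = t' := by
  rw [deliveredAt_iff] at h h'
  rcases lt_trichotomy t t' with hlt | heq | hlt
  · have := (h'.1.2.2 t h.1.1 hlt).2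
    simp [h.2] at this
  · exact heq
  · have := (h.1.2.2 t' h'.1.1 hlt).2
    simp [h'.2] at this

lemma DeliveredAt.lt {u t : ℕ} (h : DeliveredAt n a e u t) : u < t :=
  (deliveredAt_iff.1 h).1.1

lemma DeliveredAt.service_eq {u t : ℕ} (h : DeliveredAt n a e u t) :
    service n a e u = t - u := by
  have hlt := h.lt
  have : {d | DeliveredAt n a e u (u + d)} = {t - u} := by
    ext d
    simp only [Set.mem_ofPred_eq, Set.mem_singleton_iff]
    constructor
    · intro hd
      have := h.unique hd
      omega
    · rintro rfl
      rwa [Nat.add_sub_cancel' hlt.le]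
  rw [service, this, csInf_singleton]

lemma exists_least_ack {u v : ℕ} (h : ∃ i, u < i ∧ i ≤ v ∧ e i = false) :
    ∃ d, u < d ∧ d ≤ v ∧ e d = false ∧ ∀ i, u < i → i < d → e i = true := by
  classical
  have hs := Nat.find_spec h
  refine ⟨Nat.find h, hs.1, hs.2.1, hs.2.2, fun i hi hid => ?_⟩
  have := Nat.find_min h hid
  by_contra hne
  exact this ⟨hi, by omega, by simpa using hne⟩

/-- The packet is still being sent in frame `v`, where its successor arrives, so an ACK in that very
frame counts; hence the bound `i ≤ v`. -/
lemma delivered_iff_of_next_arrival {u v : ℕ} (hu : FrameArrival n a u) (huv : u < v)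
    (hno : ∀ i, u < i → i < v → ¬ FrameArrival n a i) (hv : FrameArrival n a v) :
    Delivered n a e u ↔ ∃ i, u < i ∧ i ≤ v ∧ e i = false := by
  constructor
  · rintro ⟨t, ht⟩
    rw [deliveredAt_iff] at ht
    refine ⟨t, ht.1.1, ?_, ht.2⟩
    by_contra hvt
    exact (ht.1.2.2 v huv (by omega)).1 hv
  · intro h
    obtain ⟨d, hud, hdv, hd, hlt⟩ := exists_least_ack h
    exact ⟨d, deliveredAt_iff.2
      ⟨⟨hud, hu, fun i hi hid => ⟨hno i hi (by omega), hlt i hi hid⟩⟩, hd⟩⟩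

lemma count_eq_of_forall_not {p : ℕ → Prop} [DecidablePred p] {s t : ℕ} (hst : s ≤ t)
    (h : ∀ i, s ≤ i → i < t → ¬ p i) : Nat.count p t = Nat.count p s := by
  induction t, hst using Nat.le_induction with
  | base => rfl
  | succ t hst ih =>
    rw [Nat.count_succ, if_neg (h t hst (by omega)), ih fun i h1 h2 => h i h1 (by omega),
      add_zero]

lemma nth_eq_iff_of_infinite {p : ℕ → Prop} [DecidablePred p] (hp : (Set.ofPred p).Infinite)
    {j u : ℕ} : Nat.nth p j = u ↔ p u ∧ Nat.count p u = j := by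
  constructor
  · rintro rfl
    exact ⟨Nat.nth_mem_of_infinite hp j, Nat.count_nth_of_infinite hp j⟩
  · rintro ⟨h, rfl⟩
    exact Nat.nth_count h

/-- Arrivals and acknowledgements both occur infinitely often along the sample path. -/
structure Recurrent (n : ℕ) (a e : ℕ → Bool) : Prop where
  arrival : ∀ N, ∃ u, N ≤ u ∧ FrameArrival n a u
  ack : ∀ N, ∃ t, N ≤ t ∧ e t = false

lemma infinite_of_forall_exists_le {p : ℕ → Prop} (h : ∀ N, ∃ u, N ≤ u ∧ p u) :
    (Set.ofPred p).Infinite :=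
  Set.infinite_of_forall_exists_gt fun N =>
    let ⟨u, hu, hp⟩ := h (N + 1)
    ⟨u, hp, hu⟩

lemma exists_least_ge {p : ℕ → Prop} (h : ∀ N, ∃ u, N ≤ u ∧ p u) (N : ℕ) :
    ∃ j, p (N + j) ∧ ∀ i < j, ¬ p (N + i) := by
  classical
  have h' : ∃ j, p (N + j) := by
    obtain ⟨u, hu, hp⟩ := h N
    exact ⟨u - N, by rwa [Nat.add_sub_cancel' hu]⟩
  exact ⟨Nat.find h', Nat.find_spec h', fun i hi => Nat.find_min h' hi⟩

lemma Recurrent.arrivals_infinite (h : Recurrent n a e) :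
    (Set.ofPred (FrameArrival n a)).Infinite := infinite_of_forall_exists_le h.arrival

lemma Recurrent.deliveries_infinite (h : Recurrent n a e) :
    (Set.ofPred (Delivery n a e)).Infinite := by
  refine infinite_of_forall_exists_le fun N => ?_
  obtain ⟨u, hu, hp⟩ := h.arrival N
  obtain ⟨v, hv, hev⟩ := h.ack (u + 1)
  obtain ⟨d, hud, -, hd, hlt⟩ := exists_least_ack (u := u) (v := v) ⟨v, hv, le_rfl, hev⟩
  exact ⟨d, by omega, delivery_iff.2 ⟨hd, u, hud, hp, hlt⟩⟩

lemma deliveredAt_stamp (h : (Set.ofPred (Delivery n a e)).Infinite) (m : ℕ) :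
    DeliveredAt n a e (stamp n a e m) (Nat.nth (Delivery n a e) m) := by
  obtain ⟨u, hu⟩ := Nat.nth_mem_of_infinite h m
  rwa [stamp, hu.1, Option.getD_some]

lemma stamp_add_stampService (h : (Set.ofPred (Delivery n a e)).Infinite) (m : ℕ) :
    stamp n a e m + stampService n a e m = Nat.nth (Delivery n a e) m := by
  have hd := deliveredAt_stamp h m
  have := hd.lt
  rw [stampService, hd.service_eq]
  omega

lemma lastBefore_nth (h : (Set.ofPred (Delivery n a e)).Infinite) (m : ℕ) :
    lastBefore n a e (Nat.nth (Delivery n a e) m) = m - 1 := by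
  have : {k | stamp n a e k + stampService n a e k < Nat.nth (Delivery n a e) m} = Set.Iio m := by
    ext k
    simp [stamp_add_stampService h, Nat.nth_lt_nth h]
  rw [lastBefore, this]
  cases m with
  -- Here the set is empty, and `sSup ∅ = 0` agrees with the truncated `0 - 1`.
  | zero => simp
  | succ m =>
    have : Set.Iio (m + 1) = Set.Iic m := by ext; simp
    rw [this, csSup_Iic, Nat.add_sub_cancel]

lemma peakAge_eq (h : (Set.ofPred (Delivery n a e)).Infinite) (m : ℕ) :
    peakAge n a e m = Nat.nth (Delivery n a e) m - stamp n a e (m - 1) := by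
  rw [peakAge, ageBefore, stamp_add_stampService h, lastBefore_nth h]

-- While the packet waits for its first ACK nothing can be delivered, so the count does not move.
-- The bound `u + 1` includes frame `u`, in which an older packet may still be decoded.
open Classical in
lemma DeliveredAt.count_eq {u d m : ℕ} (h : DeliveredAt n a e u d)
    (hc : Nat.count (Delivery n a e) (u + 1) = m) : Nat.count (Delivery n a e) d = m := by
  rw [← hc]
  refine count_eq_of_forall_not h.lt fun i hi hid hD => ?_
  have := ((deliveredAt_iff.1 h).1.2.2 i hi hid).2
  simp [(delivery_iff.1 hD).1] at this

open Classical in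
lemma DeliveredAt.nth_eq {u d m : ℕ} (h : DeliveredAt n a e u d)
    (hc : Nat.count (Delivery n a e) (u + 1) = m) :
    Nat.nth (Delivery n a e) m = d ∧ stamp n a e m = u := by
  have hnd : Nat.nth (Delivery n a e) m = d := by
    rw [← h.count_eq hc]
    exact Nat.nth_count ⟨u, h⟩
  exact ⟨hnd, by rw [stamp, hnd, h.1, Option.getD_some]⟩

open Classical in
lemma count_stamp_succ (h : (Set.ofPred (Delivery n a e)).Infinite) (m : ℕ) :
    Nat.count (Delivery n a e) (stamp n a e m + 1) = m := by
  rw [← (deliveredAt_stamp h m).count_eq rfl, Nat.count_nth_of_infinite h]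

open Classical in
/-- A packet enters in frame `u` after exactly `m` deliveries; the next packet enters in frame
`u + 1 + j`, when the first one has been delivered, and the first ACK after that comes in frame
`u + 2 + j + l`. -/
structure PeakEvent (n : ℕ) (a e : ℕ → Bool) (m u j l : ℕ) : Prop where
  arrival : FrameArrival n a u
  count : Nat.count (Delivery n a e) (u + 1) = m
  idle : ∀ i < j, ¬ FrameArrival n a (u + 1 + i)
  next : FrameArrival n a (u + 1 + j)
  acked : ¬ ∀ i < j + 1, e (u + 1 + i) = true
  nack : ∀ i < l, e (u + 1 + j + 1 + i) = true
  ack : e (u + 1 + j + 1 + l) = false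

/-- The heart of the path analysis: the marks determine the stamp of one delivered packet and the
time of the following delivery. The packet decoded at that time need not be the one from frame `u +
1 + j`, and its stamp is never needed. -/
lemma PeakEvent.nth_eq {m u j l : ℕ} (h : PeakEvent n a e m u j l) :
    stamp n a e m = u ∧ Nat.nth (Delivery n a e) (m + 1) = u + 1 + j + 1 + l := by
  classical
  have hac : ∃ i, u < i ∧ i ≤ u + 1 + j ∧ e i = false := by
    have := h.acked
    push Not at this
    obtain ⟨i, hi, hei⟩ := this
    exact ⟨u + 1 + i, by omega, by omega, by simpa using hei⟩
  obtain ⟨d, hud, hdv, hd, hlt⟩ := exists_least_ack hac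
  have hidle : ∀ i, u < i → i < u + 1 + j → ¬ FrameArrival n a i := fun i h1 h2 => by
    have := h.idle (i - (u + 1)) (by omega)
    rwa [Nat.add_sub_cancel' (by omega)] at this
  have hnack : ∀ i, u + 1 + j < i → i < u + 1 + j + 1 + l → e i = true := fun i h1 h2 => by
    have := h.nack (i - (u + 1 + j + 1)) (by omega)
    rwa [Nat.add_sub_cancel' (by omega)] at this
  have hdel : DeliveredAt n a e u d := deliveredAt_iff.2
    ⟨⟨hud, h.arrival, fun i hi hid => ⟨hidle i hi (by omega), hlt i hi hid⟩⟩, hd⟩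
  obtain ⟨hnd, hst⟩ := hdel.nth_eq h.count
  have hcd : Nat.count (Delivery n a e) d = m := hdel.count_eq h.count
  have hDt : Delivery n a e (u + 1 + j + 1 + l) :=
    delivery_iff.2 ⟨h.ack, u + 1 + j, by omega, h.next, hnack⟩
  have hct : Nat.count (Delivery n a e) (u + 1 + j + 1 + l) = m + 1 := by
    rw [count_eq_of_forall_not (s := d + 1) (by omega), Nat.count_succ, if_pos ⟨u, hdel⟩, hcd]
    -- No delivery between `d` and the claimed time: up to the next arrival the system is empty,
    -- since every earlier arrival precedes the ACK at `d`; afterwards all frames carry NACKs.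
    intro i hi hit hD
    obtain ⟨hei, v, hvi, hv, hvt⟩ := delivery_iff.1 hD
    rcases le_or_gt i (u + 1 + j) with hiv | hiv
    · have hvu : v ≤ u := by
        by_contra hc
        exact hidle v (by omega) (by omega) hv
      have := hvt d (by omega) (by omega)
      simp [hd] at this
    · have := hnack i hiv hit
      simp [hei] at this
  refine ⟨?_, ?_⟩
  · exact hst
  · rw [← hct]
    exact Nat.nth_count hDt

lemma PeakEvent.unique {m u j l u' j' l' : ℕ} (h : PeakEvent n a e m u j l)
    (h' : PeakEvent n a e m u' j' l') : u = u' ∧ j = j' ∧ l = l' := by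
  have hu : u = u' := h.nth_eq.1.symm.trans h'.nth_eq.1
  subst hu
  have hj : j = j' := by
    rcases lt_trichotomy j j' with hlt | heq | hlt
    · exact absurd h.next (h'.idle j hlt)
    · exact heq
    · exact absurd h'.next (h.idle j' hlt)
  have := h.nth_eq.2.symm.trans h'.nth_eq.2
  exact ⟨rfl, hj, by omega⟩

lemma Recurrent.exists_peakEvent (h : Recurrent n a e) (m : ℕ) :
    ∃ u j l, PeakEvent n a e m u j l := by
  classical
  have hdel := deliveredAt_stamp h.deliveries_infinite m
  set u := stamp n a e m
  set d := Nat.nth (Delivery n a e) m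
  have hdel' := deliveredAt_iff.1 hdel
  obtain ⟨⟨hud, hu, hlt⟩, hed⟩ := hdel'
  obtain ⟨j, hj, hidle⟩ := exists_least_ge h.arrival (u + 1)
  obtain ⟨l, hl, hnack⟩ := exists_least_ge h.ack (u + 1 + j + 1)
  have hdj : d ≤ u + 1 + j := by
    by_contra hc
    exact (hlt (u + 1 + j) (by omega) (by omega)).1 hj
  refine ⟨u, j, l, hu, count_stamp_succ h.deliveries_infinite m, hidle, hj, fun hall => ?_,
    fun i hi => by simpa using hnack i hi, hl⟩
  have := hall (d - (u + 1)) (by omega)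
  rw [Nat.add_sub_cancel' (by omega)] at this
  simp [hed] at this

lemma PeakEvent.peakAge_eq (hr : Recurrent n a e) {m u j l : ℕ} (h : PeakEvent n a e m u j l) :
    peakAge n a e (m + 1) = (j + 1) + (l + 1) := by
  rw [PeakAge.peakAge_eq hr.deliveries_infinite, Nat.add_sub_cancel, h.nth_eq.1, h.nth_eq.2]
  omega

open Classical in
/-- A packet arrives in frame `u`, after exactly `m` deliveries. -/
def ArrivalAfter (n : ℕ) (a e : ℕ → Bool) (m u : ℕ) : Prop :=
  FrameArrival n a u ∧ Nat.count (Delivery n a e) (u + 1) = m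

/-- Under the convention for index 0 the packet is compared with itself, so the value is its own
service time. This serves only measurability. -/
lemma ArrivalAfter.peakAge_zero (hr : Recurrent n a e) {u k : ℕ} (h : ArrivalAfter n a e 0 u)
    (hd : DeliveredAt n a e u (u + 1 + k)) : peakAge n a e 0 = k + 1 := by
  obtain ⟨h1, h2⟩ := hd.nth_eq h.2
  rw [peakAge_eq hr.deliveries_infinite, h1, h2]
  omega

lemma Recurrent.exists_arrivalAfter (hr : Recurrent n a e) (m : ℕ) :
    ∃ u k, ArrivalAfter n a e m u ∧ DeliveredAt n a e u (u + 1 + k) := by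
  have hd := deliveredAt_stamp hr.deliveries_infinite m
  have hlt := hd.lt
  refine ⟨stamp n a e m, Nat.nth (Delivery n a e) m - (stamp n a e m + 1),
    ⟨(deliveredAt_iff.1 hd).1.2.1, count_stamp_succ hr.deliveries_infinite m⟩, ?_⟩
  rwa [Nat.add_sub_cancel' hlt]

open Classical in
/-- Frame `u` is the `j`th frame with an arrival, counted from `0`. -/
def IsArrival (n : ℕ) (a : ℕ → Bool) (j u : ℕ) : Prop :=
  FrameArrival n a u ∧ Nat.count (FrameArrival n a) u = j

lemma Recurrent.isArrival_iff (h : Recurrent n a e) {j u : ℕ} :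
    IsArrival n a j u ↔ arrivalStamp n a j = u := by
  classical
  rw [arrivalStamp, nth_eq_iff_of_infinite h.arrivals_infinite]
  unfold IsArrival
  convert Iff.rfl

lemma IsArrival.arrivalStamp_eq {j u : ℕ} (h : IsArrival n a j u) : arrivalStamp n a j = u := by
  classical
  rw [arrivalStamp, ← h.2]
  convert Nat.nth_count h.1

lemma IsArrival.interarrival_eq {j u k : ℕ} (h : IsArrival n a j u)
    (hidle : ∀ i < k, ¬ FrameArrival n a (u + 1 + i)) (hnext : FrameArrival n a (u + 1 + k)) :
    interarrival n a j = k + 1 := by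
  classical
  have : IsArrival n a (j + 1) (u + 1 + k) := by
    refine ⟨hnext, ?_⟩
    rw [count_eq_of_forall_not (s := u + 1) (by omega), Nat.count_succ, if_pos h.1, h.2]
    intro i hi hik
    have := hidle (i - (u + 1)) (by omega)
    rwa [Nat.add_sub_cancel' hi] at this
  rw [interarrival, h.arrivalStamp_eq, this.arrivalStamp_eq]
  omega

lemma deliveredAt_add_iff {u d : ℕ} (hu : FrameArrival n a u) :
    DeliveredAt n a e u (u + 1 + d) ↔
      (∀ i < d, ¬ FrameArrival n a (u + 1 + i) ∧ e (u + 1 + i) = true) ∧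
        e (u + 1 + d) = false := by
  rw [deliveredAt_iff]
  constructor
  · rintro ⟨⟨-, -, h⟩, hd⟩
    exact ⟨fun i hi => h _ (by omega) (by omega), hd⟩
  · rintro ⟨h, hd⟩
    refine ⟨⟨by omega, hu, fun i hi hid => ?_⟩, hd⟩
    have := h (i - (u + 1)) (by omega)
    rwa [Nat.add_sub_cancel' hi] at this

lemma delivered_iff_of_next_arrival_add {u j : ℕ} (hu : FrameArrival n a u)
    (hidle : ∀ i < j, ¬ FrameArrival n a (u + 1 + i)) (hnext : FrameArrival n a (u + 1 + j)) :
    Delivered n a e u ↔ ¬ ∀ i < j + 1, e (u + 1 + i) = true := by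
  rw [delivered_iff_of_next_arrival hu (v := u + 1 + j) (by omega) _ hnext]
  · push Not
    constructor
    · rintro ⟨i, h1, h2, h3⟩
      exact ⟨i - (u + 1), by omega, by rw [Nat.add_sub_cancel' h1, h3]; simp⟩
    · rintro ⟨i, h1, h2⟩
      exact ⟨u + 1 + i, by omega, by omega, by simpa using h2⟩
  · intro i hi hij
    have := hidle (i - (u + 1)) (by omega)
    rwa [Nat.add_sub_cancel' hi] at this

end PathLemmas

end PeakAge

namespace PeakAge

/-! ### Expectations of variables that are constant on countably many pieces -/

section Partition

variable {Ω : Type*} [MeasurableSpace Ω] {P : Measure Ω}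

lemma aemeasurable_of_partition {ι : Type*} [Countable ι] {E : ι → Set Ω}
    (hE : ∀ i, MeasurableSet (E i)) (hS : ∀ᵐ ω ∂P, ∃ i, ω ∈ E i) {X : Ω → ℕ} {x : ι → ℕ}
    (hX : ∀ᵐ ω ∂P, ∀ i, ω ∈ E i → X ω = x i) : AEMeasurable X P := by
  have h : AEMeasurable X (P.restrict (⋃ i, E i)) := by
    rw [aemeasurable_iUnion_iff]
    intro i
    refine (aemeasurable_const (b := x i)).congr ?_
    rw [EventuallyEq, ae_restrict_iff' (hE i)]
    filter_upwards [hX] with ω hω hi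
    rw [hω i hi]
  rwa [Measure.restrict_eq_self_of_ae_mem] at h
  filter_upwards [hS] with ω hω
  simpa using hω

variable [IsProbabilityMeasure P]

lemma hasSum_setIntegral_of_partition {ι : Type*} [Countable ι] {S : Set Ω} {E : ι → Set Ω}
    (hE : ∀ i, MeasurableSet (E i)) (hd : Pairwise (Function.onFun Disjoint E))
    (hS : ∀ᵐ ω ∂P, ω ∈ S ↔ ∃ i, ω ∈ E i) {X : Ω → ℕ} {x : ι → ℕ}
    (hX : ∀ᵐ ω ∂P, ∀ i, ω ∈ E i → X ω = x i) {f : ℕ → ℂ} (hf : ∀ k, ‖f k‖ ≤ 1) :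
    HasSum (fun i => (P.real (E i) : ℂ) * f (x i)) (∫ ω in S, f (X ω) ∂P) := by
  have hS' : S =ᵐ[P] ⋃ i, E i := eventuallyEq_set.2 (by simpa only [Set.mem_iUnion] using hS)
  rw [setIntegral_congr_set hS']
  have hconst : ∀ i, (fun ω => f (X ω)) =ᵐ[P.restrict (E i)] fun _ => f (x i) := fun i => by
    rw [EventuallyEq, ae_restrict_iff' (hE i)]
    filter_upwards [hX] with ω hω hi
    rw [hω i hi]
  have hmeas : AEStronglyMeasurable (fun ω => f (X ω)) (P.restrict (⋃ i, E i)) := by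
    rw [aestronglyMeasurable_iUnion_iff]
    exact fun i => aestronglyMeasurable_const.congr (hconst i).symm
  have hint : IntegrableOn (fun ω => f (X ω)) (⋃ i, E i) P :=
    Integrable.of_bound hmeas 1 (ae_of_all _ fun ω => hf _)
  have hterm : ∀ i, ∫ ω in E i, f (X ω) ∂P = (P.real (E i) : ℂ) * f (x i) := fun i => by
    rw [integral_congr_ae (hconst i), setIntegral_const, Complex.real_smul]
  simpa only [hterm] using hasSum_integral_iUnion hE hd hint

/-- Decomposition of an expectation according to a random index `u` and a mark `i` whose weight
`w i` does not depend on `u`. -/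
lemma setIntegral_of_renewal {ι : Type*} [Countable ι] {S : Set Ω} {C : ℕ → Set Ω}
    {E : ℕ → ι → Set Ω} (hE : ∀ u i, MeasurableSet (E u i))
    (hd : ∀ ω u i u' i', ω ∈ E u i → ω ∈ E u' i' → u = u' ∧ i = i')
    (hS : ∀ᵐ ω ∂P, ω ∈ S ↔ ∃ u i, ω ∈ E u i) {w : ι → ℝ} (hw : Summable w)
    {i₀ : ι} (hi₀ : w i₀ ≠ 0)
    (hP : ∀ u i, P.real (E u i) = P.real (C u) * w i) {X : Ω → ℕ} {x : ι → ℕ}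
    (hX : ∀ᵐ ω ∂P, ∀ u i, ω ∈ E u i → X ω = x i) {f : ℕ → ℂ} (hf : ∀ k, ‖f k‖ ≤ 1) :
    ∫ ω in S, f (X ω) ∂P = ((∑' u, P.real (C u) : ℝ) : ℂ) * ∑' i, (w i : ℂ) * f (x i) := by
  have h : ∀ g : ℕ → ℂ, (∀ k, ‖g k‖ ≤ 1) →
      HasSum (fun q : ℕ × ι => (P.real (E q.1 q.2) : ℂ) * g (x q.2))
        (∫ ω in S, g (X ω) ∂P) := fun g hg =>
    hasSum_setIntegral_of_partition
      (E := fun q : ℕ × ι => E q.1 q.2) (x := fun q => x q.2) (fun q => hE _ _)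
      (fun q q' hq => Set.disjoint_left.2 fun ω h1 h2 =>
        hq (Prod.ext (hd ω _ _ _ _ h1 h2).1 (hd ω _ _ _ _ h1 h2).2))
      (by
        filter_upwards [hS] with ω hω
        rw [hω, Prod.exists])
      (by
        filter_upwards [hX] with ω hω q hq
        exact hω _ _ hq) hg
  -- The sets `C u` may overlap, so their probabilities need not sum to at most 1. Summability comes
  -- from the disjoint pieces with the single mark `i₀`, whose probabilities are a nonzero multiple
  -- of those of `C u`.
  have hCs : Summable fun u => P.real (C u) := by
    have h1 := (h (fun _ => 1) (by simp)).summable.comp_injective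
      (i := fun u : ℕ => (u, i₀)) (fun u u' huu => congrArg Prod.fst huu)
    simp only [Function.comp_def, hP, mul_one] at h1
    exact (summable_mul_right_iff hi₀).1 (Complex.summable_ofReal.1 h1)
  rw [← (h f hf).tsum_eq, Complex.ofReal_tsum, tsum_mul_tsum_of_summable_norm]
  · refine tsum_congr fun q => ?_
    simp only [hP]
    push_cast
    ring
  · simpa [abs_of_nonneg] using hCs
  · refine hw.abs.of_nonneg_of_le (fun i => norm_nonneg _) fun i => ?_
    rw [norm_mul, Complex.norm_real, Real.norm_eq_abs]
    exact mul_le_of_le_one_right (abs_nonneg _) (hf _)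

end Partition

end PeakAge

namespace PeakAge

/-! ### Frame states and the information carried by past and present frames -/

section Frames

variable {Ω : Type*} (n : ℕ) (arr err : ℕ → Ω → Bool)

open Classical in
/-- Arrival indicator and NACK indicator of frame `t`. -/
noncomputable def state (t : ℕ) (ω : Ω) : Bool × Bool :=
  (decide (FrameArrival n (fun c => arr c ω) t), err t ω)

/-- Events that depend only on the frames before frame `u`. -/
@[reducible] def past (u : ℕ) : MeasurableSpace Ω :=
  ⨆ i ∈ {i : ℕ ⊕ ℕ | Sum.elim (· < u * n) (· < u) i},
    MeasurableSpace.comap (Sum.elim arr err i) inferInstance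

/-- Events that depend only on frame `u`. -/
@[reducible] def present (u : ℕ) : MeasurableSpace Ω :=
  ⨆ i ∈ {i : ℕ ⊕ ℕ | Sum.elim (fun c => u * n ≤ c ∧ c < u * n + n) (· = u) i},
    MeasurableSpace.comap (Sum.elim arr err i) inferInstance

variable {n arr err}

lemma state_fst {t : ℕ} {ω : Ω} :
    (state n arr err t ω).1 = true ↔ FrameArrival n (fun c => arr c ω) t := by
  simp [state]

lemma state_fst_false {t : ℕ} {ω : Ω} :
    (state n arr err t ω).1 = false ↔ ¬ FrameArrival n (fun c => arr c ω) t := by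
  simp [state]

lemma state_snd {t : ℕ} {ω : Ω} : (state n arr err t ω).2 = err t ω := rfl

lemma measurable_state {m : MeasurableSpace Ω} {t : ℕ}
    (ha : ∀ i < n, Measurable (arr (t * n + i))) (he : Measurable (err t)) :
    Measurable (state n arr err t) := by
  classical
  refine Measurable.prodMk (measurable_to_bool ?_) he
  have : (fun ω => decide (FrameArrival n (fun c => arr c ω) t)) ⁻¹' {true} =
      ⋃ i, ⋃ (_ : i < n), arr (t * n + i) ⁻¹' {true} := by
    ext ω
    simp only [Set.mem_preimage, Set.mem_singleton_iff, decide_eq_true_eq, Set.mem_iUnion,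
      exists_prop]
    rfl
  rw [this]
  exact MeasurableSet.iUnion fun i => MeasurableSet.iUnion fun hi =>
    ha i hi (measurableSet_singleton _)

lemma measurable_state_present (u : ℕ) : Measurable[present n arr err u] (state n arr err u) := by
  refine measurable_state (m := present n arr err u) (fun i hi => ?_) ?_
  · exact Measurable.mono (comap_measurable (arr (u * n + i)))
      (le_biSup (fun i => MeasurableSpace.comap (Sum.elim arr err i) inferInstance)
        (i := Sum.inl (u * n + i)) (by simpa using hi)) le_rfl
  · exact Measurable.mono (comap_measurable (err u))
      (le_biSup (fun i => MeasurableSpace.comap (Sum.elim arr err i) inferInstance)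
        (i := Sum.inr u) (by simp)) le_rfl

lemma past_mono {u v : ℕ} (h : u ≤ v) : past n arr err u ≤ past n arr err v := by
  refine biSup_mono fun i hi => ?_
  cases i with
  | inl c => exact lt_of_lt_of_le hi (Nat.mul_le_mul_right n h)
  | inr t => exact lt_of_lt_of_le hi h

lemma present_le_past {u v : ℕ} (h : u < v) : present n arr err u ≤ past n arr err v := by
  refine biSup_mono fun i hi => ?_
  cases i with
  | inl c =>
    refine lt_of_lt_of_le hi.2 ?_
    rw [← Nat.succ_mul]
    exact Nat.mul_le_mul_right n h
  | inr t =>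
    obtain rfl : t = u := hi
    exact h

lemma measurable_state_past {u v : ℕ} (h : u < v) :
    Measurable[past n arr err v] (state n arr err u) :=
  Measurable.mono (measurable_state_present u) (present_le_past h) le_rfl

lemma measurableSet_arrival {m : MeasurableSpace Ω} {t : ℕ} (h : Measurable (state n arr err t)) :
    MeasurableSet {ω | FrameArrival n (fun c => arr c ω) t} := by
  simp_rw [← state_fst (err := err)]
  exact h.fst (measurableSet_singleton true)

lemma measurable_count {m : MeasurableSpace Ω} {p : ℕ → Ω → Prop}
    [∀ ω, DecidablePred fun t => p t ω] {u : ℕ} (h : ∀ t < u, MeasurableSet {ω | p t ω}) :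
    Measurable fun ω => Nat.count (fun t => p t ω) u := by
  induction u with
  | zero => simp
  | succ u ih =>
    simp_rw [Nat.count_succ]
    exact (ih fun t ht => h t (by omega)).add
      (Measurable.ite (h u (by omega)) measurable_const measurable_const)

lemma measurableSet_isArrival {m : MeasurableSpace Ω} {u : ℕ}
    (h : ∀ t ≤ u, Measurable (state n arr err t)) (j : ℕ) :
    MeasurableSet {ω | IsArrival n (fun c => arr c ω) j u} := by
  classical
  exact (measurableSet_arrival (h u le_rfl)).inter
    (measurable_count (p := fun t ω => FrameArrival n (fun c => arr c ω) t)
      (fun t ht => measurableSet_arrival (h t ht.le)) (measurableSet_singleton j))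

lemma measurableSet_delivery {m : MeasurableSpace Ω} {u : ℕ}
    (h : ∀ t ≤ u, Measurable (state n arr err t)) :
    MeasurableSet {ω | Delivery n (fun c => arr c ω) (fun t => err t ω) u} := by
  have : {ω | Delivery n (fun c => arr c ω) (fun t => err t ω) u} =
      {ω | (state n arr err u ω).2 = false} ∩
        ⋃ v, ⋃ (_ : v < u), {ω | FrameArrival n (fun c => arr c ω) v} ∩
          ⋂ i, ⋂ (_ : v < i), ⋂ (_ : i < u), {ω | (state n arr err i ω).2 = true} := by
    ext ω
    simp only [delivery_iff, state_snd, Set.mem_ofPred_eq, Set.mem_inter_iff, Set.mem_iUnion,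
      Set.mem_iInter, exists_prop]
  rw [this]
  refine ((h u le_rfl).snd (measurableSet_singleton false)).inter ?_
  exact MeasurableSet.iUnion fun v => MeasurableSet.iUnion fun hv =>
    (measurableSet_arrival (h v hv.le)).inter (MeasurableSet.iInter fun i =>
      MeasurableSet.iInter fun _ => MeasurableSet.iInter fun hi =>
        (h i hi.le).snd (measurableSet_singleton true))

lemma measurableSet_arrivalAfter {m : MeasurableSpace Ω} {u : ℕ}
    (h : ∀ t ≤ u, Measurable (state n arr err t)) (k : ℕ) :
    MeasurableSet {ω | ArrivalAfter n (fun c => arr c ω) (fun t => err t ω) k u} := by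
  classical
  exact (measurableSet_arrival (h u le_rfl)).inter
    (measurable_count (p := fun t ω => Delivery n (fun c => arr c ω) (fun t => err t ω) t)
      (fun t ht => measurableSet_delivery fun s hs => h s (by omega)) (measurableSet_singleton k))

lemma measurableSet_run {u : ℕ} {C : Set Ω} (hC : MeasurableSet[past n arr err u] C)
    (Q : Set (Bool × Bool)) (j : ℕ) :
    MeasurableSet[past n arr err (u + j)]
      (C ∩ {ω | ∀ i < j, state n arr err (u + i) ω ∈ Q}) := by
  refine @MeasurableSet.inter _ (past n arr err (u + j)) _ _
    (past_mono (Nat.le_add_right u j) C hC) ?_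
  have : {ω | ∀ i < j, state n arr err (u + i) ω ∈ Q} =
      ⋂ i, ⋂ (_ : i < j), {ω | state n arr err (u + i) ω ∈ Q} := by
    ext ω
    simp
  rw [this]
  exact MeasurableSet.iInter fun i => MeasurableSet.iInter fun hi =>
    measurable_state_past (by omega) (MeasurableSet.of_discrete (s := Q))

lemma measurableSet_run_then {u : ℕ} {C : Set Ω} (hC : MeasurableSet[past n arr err u] C)
    (Q R : Set (Bool × Bool)) (j : ℕ) :
    MeasurableSet[past n arr err (u + j + 1)]
      ((C ∩ {ω | ∀ i < j, state n arr err (u + i) ω ∈ Q}) ∩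
        {ω | state n arr err (u + j) ω ∈ R}) :=
  @MeasurableSet.inter _ (past n arr err (u + j + 1)) _ _
    (past_mono (Nat.le_succ _) _ (measurableSet_run hC Q j))
    (measurable_state_past (Nat.lt_succ_self _) (MeasurableSet.of_discrete (s := R)))

end Frames

/-! ### Independence of frames and probabilities of runs -/

section Independence

variable {Ω : Type*} [mΩ : MeasurableSpace Ω] {P : Measure Ω}
  {n : ℕ} {arr err : ℕ → Ω → Bool}

lemma past_le (ha : ∀ c, Measurable (arr c)) (he : ∀ t, Measurable (err t)) (u : ℕ) :
    past n arr err u ≤ mΩ := by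
  refine iSup₂_le fun i _ => Measurable.comap_le ?_
  cases i with
  | inl c => exact ha c
  | inr t => exact he t

/-- The two σ-algebras are generated by disjoint subfamilies of the independent family of arrivals
and failures. -/
lemma indep_past_present (ha : ∀ c, Measurable (arr c)) (he : ∀ t, Measurable (err t))
    (hi : iIndepFun (Sum.elim arr err) P) (u : ℕ) :
    Indep (past n arr err u) (present n arr err u) P := by
  refine indep_iSup_of_disjoint (fun i => Measurable.comap_le ?_) hi.iIndep ?_
  · cases i with
    | inl c => exact ha c
    | inr t => exact he t
  · rw [Set.disjoint_left]
    rintro (c | t) h1 h2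
    · exact absurd h1 (not_lt.2 h2.1)
    · exact absurd h1 (not_lt.2 (le_of_eq (Eq.symm h2)))

lemma measureReal_inter_state (ha : ∀ c, Measurable (arr c)) (he : ∀ t, Measurable (err t))
    (hi : iIndepFun (Sum.elim arr err) P) {u : ℕ} {C : Set Ω}
    (hC : MeasurableSet[past n arr err u] C) (Q : Set (Bool × Bool)) :
    P.real (C ∩ {ω | state n arr err u ω ∈ Q}) =
      P.real C * P.real {ω | state n arr err u ω ∈ Q} := by
  have h := (Indep_iff _ _ _).1 (indep_past_present ha he hi u) C _ hC
    (measurable_state_present u (MeasurableSet.of_discrete (s := Q)))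
  exact (congrArg ENNReal.toReal h).trans ENNReal.toReal_mul

lemma measureReal_run (ha : ∀ c, Measurable (arr c)) (he : ∀ t, Measurable (err t))
    (hi : iIndepFun (Sum.elim arr err) P) {u : ℕ} {C : Set Ω}
    (hC : MeasurableSet[past n arr err u] C) {Q : Set (Bool × Bool)} {r : ℝ}
    (hr : ∀ t, P.real {ω | state n arr err t ω ∈ Q} = r) (j : ℕ) :
    P.real (C ∩ {ω | ∀ i < j, state n arr err (u + i) ω ∈ Q}) = P.real C * r ^ j := by
  induction j with
  | zero => simp
  | succ j ih =>
    have : C ∩ {ω | ∀ i < j + 1, state n arr err (u + i) ω ∈ Q} =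
        (C ∩ {ω | ∀ i < j, state n arr err (u + i) ω ∈ Q}) ∩
          {ω | state n arr err (u + j) ω ∈ Q} := by
      ext ω
      simp only [Set.mem_inter_iff, Set.mem_ofPred_eq, Nat.forall_lt_succ_right, and_assoc]
    rw [this, measureReal_inter_state ha he hi (measurableSet_run hC Q j), ih, hr]
    ring

lemma measureReal_run_then (ha : ∀ c, Measurable (arr c)) (he : ∀ t, Measurable (err t))
    (hi : iIndepFun (Sum.elim arr err) P) {u : ℕ} {C : Set Ω}
    (hC : MeasurableSet[past n arr err u] C) {Q R : Set (Bool × Bool)} {q r : ℝ}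
    (hq : ∀ t, P.real {ω | state n arr err t ω ∈ Q} = q)
    (hr : ∀ t, P.real {ω | state n arr err t ω ∈ R} = r) (j : ℕ) :
    P.real ((C ∩ {ω | ∀ i < j, state n arr err (u + i) ω ∈ Q}) ∩
      {ω | state n arr err (u + j) ω ∈ R}) = P.real C * (q ^ j * r) := by
  rw [measureReal_inter_state ha he hi (measurableSet_run hC Q j),
    measureReal_run ha he hi hC hq, hr, mul_assoc]

variable [IsProbabilityMeasure P]

lemma ae_forall_exists_notMem (ha : ∀ c, Measurable (arr c)) (he : ∀ t, Measurable (err t))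
    (hi : iIndepFun (Sum.elim arr err) P) {Q : Set (Bool × Bool)} {r : ℝ} (hr1 : r < 1)
    (hr : ∀ t, P.real {ω | state n arr err t ω ∈ Q} = r) :
    ∀ᵐ ω ∂P, ∀ N, ∃ u, N ≤ u ∧ state n arr err u ω ∉ Q := by
  rw [ae_all_iff]
  intro N
  have hr0 : 0 ≤ r := hr 0 ▸ measureReal_nonneg
  -- Never leaving `Q` from frame `N` on forces a run of length `j` in `Q`, for every `j`.
  have hle : ∀ j : ℕ, P.real {ω | ¬ ∃ u, N ≤ u ∧ state n arr err u ω ∉ Q} ≤ r ^ j := fun j => by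
    have := measureReal_run ha he hi (n := n) (u := N) (C := Set.univ) MeasurableSet.univ hr j
    rw [probReal_univ, one_mul] at this
    rw [← this]
    refine measureReal_mono fun ω hω => ⟨trivial, fun i _ => ?_⟩
    by_contra hc
    exact hω ⟨N + i, Nat.le_add_right _ _, hc⟩
  have h0 : P.real {ω | ¬ ∃ u, N ≤ u ∧ state n arr err u ω ∉ Q} = 0 :=
    le_antisymm (ge_of_tendsto' (tendsto_pow_atTop_nhds_zero_of_lt_one hr0 hr1) hle)
      measureReal_nonneg
  rw [ae_iff]
  exact (measureReal_eq_zero_iff).1 h0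

end Independence

end PeakAge

namespace PeakAge

/-! ### Bernoulli law of a frame and of the pattern up to the next arrival -/

section Law

set_option linter.unusedSectionVars false

/-- Independent Bernoulli arrivals, with parameter `lam`, and NACKs, with parameter `eps`. -/
structure IsLink {Ω : Type*} [MeasurableSpace Ω] (P : Measure Ω) (lam eps : ℝ)
    (arr err : ℕ → Ω → Bool) : Prop where
  lam_pos : 0 < lam
  lam_le : lam ≤ 1
  eps_nonneg : 0 ≤ eps
  eps_lt : eps < 1
  arr_meas : ∀ c, Measurable (arr c)
  err_meas : ∀ t, Measurable (err t)
  indep : iIndepFun (Sum.elim arr err) P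
  arr_prob : ∀ c, P {ω | arr c ω = true} = ENNReal.ofReal lam
  err_prob : ∀ t, P {ω | err t ω = true} = ENNReal.ofReal eps

variable {Ω : Type*} [mΩ : MeasurableSpace Ω] {P : Measure Ω} [IsProbabilityMeasure P]
  {n : ℕ} {lam eps : ℝ} {arr err : ℕ → Ω → Bool}

namespace IsLink

lemma arr_false (h : IsLink P lam eps arr err) (c : ℕ) :
    P.real (arr c ⁻¹' {false}) = 1 - lam := by
  have h1 : arr c ⁻¹' {false} = (arr c ⁻¹' {true})ᶜ := by
    ext ω
    simp
  rw [h1, probReal_compl_eq_one_sub (h.arr_meas c (measurableSet_singleton _))]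
  have h2 : P.real (arr c ⁻¹' {true}) = lam := by
    have := congrArg ENNReal.toReal (h.arr_prob c)
    rwa [ENNReal.toReal_ofReal h.lam_pos.le] at this
  rw [h2]

lemma err_true (h : IsLink P lam eps arr err) (t : ℕ) : P.real (err t ⁻¹' {true}) = eps := by
  have := congrArg ENNReal.toReal (h.err_prob t)
  rwa [ENNReal.toReal_ofReal h.eps_nonneg] at this

lemma prob_idle_inter (h : IsLink P lam eps arr err) (t : ℕ) (B : Set Bool) :
    P.real {ω | ¬ FrameArrival n (fun c => arr c ω) t ∧ err t ω ∈ B} =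
      (1 - lam) ^ n * P.real (err t ⁻¹' B) := by
  have hset : {ω | ¬ FrameArrival n (fun c => arr c ω) t ∧ err t ω ∈ B} =
      ⋂ i ∈ (Finset.Ico (t * n) (t * n + n)).disjSum {t},
        Sum.elim arr err i ⁻¹' Sum.elim (fun _ => {false}) (fun _ => B) i := by
    ext ω
    simp only [FrameArrival, Set.mem_ofPred_eq, Set.mem_iInter, Set.mem_preimage, Sum.forall,
      Finset.inl_mem_disjSum, Finset.inr_mem_disjSum, Finset.mem_Ico, Finset.mem_singleton,
      Sum.elim_inl, Sum.elim_inr, Set.mem_singleton_iff, forall_eq, not_exists, not_and,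
      Bool.not_eq_true]
    refine and_congr_left fun _ => ⟨fun hi c hc => ?_, fun hc i hi => hc _ ⟨by omega, by omega⟩⟩
    have := hi (c - t * n) (by omega)
    rwa [Nat.add_sub_cancel' hc.1] at this
  rw [hset, measureReal_def,
    iIndepFun_iff_measure_inter_preimage_eq_mul.1 h.indep _ fun _ _ => MeasurableSet.of_discrete,
    Finset.prod_disjSum, ENNReal.toReal_mul, ENNReal.toReal_prod]
  simp only [Sum.elim_inl, Sum.elim_inr, Finset.prod_singleton]
  congr 1
  calc ∏ c ∈ Finset.Ico (t * n) (t * n + n), (P (arr c ⁻¹' {false})).toReal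
      = ∏ c ∈ Finset.Ico (t * n) (t * n + n), (1 - lam) :=
        Finset.prod_congr rfl fun c _ => h.arr_false c
    _ = (1 - lam) ^ n := by rw [Finset.prod_const, Nat.card_Ico, Nat.add_sub_cancel_left]

lemma prob_idle (h : IsLink P lam eps arr err) (t : ℕ) :
    P.real {ω | state n arr err t ω ∈ {z : Bool × Bool | z.1 = false}} = (1 - lam) ^ n := by
  have := h.prob_idle_inter (n := n) t Set.univ
  rw [Set.preimage_univ, probReal_univ, mul_one] at this
  simpa [state_fst_false] using this

lemma prob_idle_nack (h : IsLink P lam eps arr err) (t : ℕ) :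
    P.real {ω | state n arr err t ω ∈ {z : Bool × Bool | z.1 = false ∧ z.2 = true}} =
      (1 - lam) ^ n * eps := by
  have := h.prob_idle_inter (n := n) t {true}
  rw [h.err_true] at this
  simpa [state_fst_false, state_snd] using this

lemma prob_nack (h : IsLink P lam eps arr err) (t : ℕ) :
    P.real {ω | state n arr err t ω ∈ {z : Bool × Bool | z.2 = true}} = eps :=
  h.err_true t

lemma measurable_state (h : IsLink P lam eps arr err) (t : ℕ) :
    Measurable (state n arr err t) :=
  PeakAge.measurable_state (fun _ _ => h.arr_meas _) (h.err_meas t)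

lemma prob_ack (h : IsLink P lam eps arr err) (t : ℕ) :
    P.real {ω | state n arr err t ω ∈ {z : Bool × Bool | z.2 = false}} = 1 - eps := by
  have hm : MeasurableSet {ω | state n arr err t ω ∈ {z : Bool × Bool | z.2 = true}} :=
    h.measurable_state t MeasurableSet.of_discrete
  rw [← h.prob_nack (n := n) t, ← probReal_compl_eq_one_sub hm]
  congr 1
  ext ω
  simp

lemma prob_arrival (h : IsLink P lam eps arr err) (t : ℕ) :
    P.real {ω | state n arr err t ω ∈ {z : Bool × Bool | z.1 = true}} = 1 - (1 - lam) ^ n := by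
  have hm : MeasurableSet {ω | state n arr err t ω ∈ {z : Bool × Bool | z.1 = false}} :=
    h.measurable_state t MeasurableSet.of_discrete
  rw [← h.prob_idle (n := n) t, ← probReal_compl_eq_one_sub hm]
  congr 1
  ext ω
  simp

lemma prob_arrival_nack (h : IsLink P lam eps arr err) (t : ℕ) :
    P.real {ω | state n arr err t ω ∈ {z : Bool × Bool | z.1 = true ∧ z.2 = true}} =
      eps - (1 - lam) ^ n * eps := by
  rw [← h.prob_idle_nack (n := n) t, eq_sub_iff_add_eq]
  conv_rhs => rw [← h.prob_nack (n := n) t]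
  rw [← measureReal_union]
  · congr 1
    ext ω
    rcases hs : (state n arr err t ω).1 <;> simp [hs]
  · rw [Set.disjoint_left]
    rintro ω ⟨h1, -⟩ ⟨h2, -⟩
    exact absurd (h1.symm.trans h2) (by simp)
  · exact h.measurable_state t (MeasurableSet.of_discrete
      (s := {z : Bool × Bool | z.1 = false ∧ z.2 = true}))

lemma pow_nonneg (h : IsLink P lam eps arr err) : 0 ≤ (1 - lam) ^ n :=
  _root_.pow_nonneg (by linarith [h.lam_le]) n

lemma pow_lt_one (h : IsLink P lam eps arr err) (hn : 1 ≤ n) : (1 - lam) ^ n < 1 :=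
  pow_lt_one₀ (by linarith [h.lam_le]) (by linarith [h.lam_pos]) (by omega)

lemma ae_recurrent (h : IsLink P lam eps arr err) (hn : 1 ≤ n) :
    ∀ᵐ ω ∂P, Recurrent n (fun c => arr c ω) (fun t => err t ω) := by
  filter_upwards [ae_forall_exists_notMem h.arr_meas h.err_meas h.indep (h.pow_lt_one hn)
      h.prob_idle,
    ae_forall_exists_notMem h.arr_meas h.err_meas h.indep h.eps_lt (h.prob_nack (n := n))]
    with ω h1 h2
  refine ⟨fun N => ?_, fun N => ?_⟩
  · obtain ⟨u, hu, hs⟩ := h1 N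
    refine ⟨u, hu, ?_⟩
    simpa [state_fst_false] using hs
  · obtain ⟨u, hu, hs⟩ := h2 N
    refine ⟨u, hu, ?_⟩
    simpa [state_snd] using hs

lemma past_le (h : IsLink P lam eps arr err) (u : ℕ) : past n arr err u ≤ mΩ :=
  PeakAge.past_le h.arr_meas h.err_meas u

end IsLink

/-- `C` occurs, and the first arrival after frame `u` takes place in frame `u + 1 + j`. -/
def nextEvent (n : ℕ) (arr : ℕ → Ω → Bool) (C : Set Ω) (u j : ℕ) : Set Ω :=
  {ω | ω ∈ C ∧ (∀ i < j, ¬ FrameArrival n (fun c => arr c ω) (u + 1 + i)) ∧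
    FrameArrival n (fun c => arr c ω) (u + 1 + j)}

/-- `C` occurs, the first arrival after frame `u` takes place in frame `u + 1 + j`, and there is an ACK in
one of the frames `u + 1, …, u + 1 + j`. -/
def ackedEvent (n : ℕ) (arr err : ℕ → Ω → Bool) (C : Set Ω) (u j : ℕ) : Set Ω :=
  {ω | ω ∈ nextEvent n arr C u j ∧ ¬ ∀ i < j + 1, err (u + 1 + i) ω = true}

lemma nextEvent_eq (C : Set Ω) (u j : ℕ) : nextEvent n arr C u j =
    (C ∩ {ω | ∀ i < j, state n arr err (u + 1 + i) ω ∈ {z : Bool × Bool | z.1 = false}}) ∩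
      {ω | state n arr err (u + 1 + j) ω ∈ {z : Bool × Bool | z.1 = true}} := by
  ext ω
  simp only [nextEvent, Set.mem_ofPred_eq, Set.mem_inter_iff, state_fst_false, state_fst,
    and_assoc]

/-- Having at least one ACK is not a product event, but its complement is: every idle frame has a
NACK, and so does the arrival frame. The difference therefore involves two products over frames. -/
lemma ackedEvent_eq (C : Set Ω) (u j : ℕ) : ackedEvent n arr err C u j =
    nextEvent n arr C u j \
    ((C ∩ {ω | ∀ i < j, state n arr err (u + 1 + i) ω ∈
        {z : Bool × Bool | z.1 = false ∧ z.2 = true}}) ∩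
      {ω | state n arr err (u + 1 + j) ω ∈ {z : Bool × Bool | z.1 = true ∧ z.2 = true}}) := by
  ext ω
  simp only [ackedEvent, nextEvent, Set.mem_sdiff, Set.mem_ofPred_eq, Set.mem_inter_iff,
    state_fst_false, state_fst, state_snd]
  refine and_congr_right fun ⟨h1, h2, h3⟩ => not_congr ?_
  constructor
  · exact fun h => ⟨⟨h1, fun i hi => ⟨h2 i hi, h i (by omega)⟩⟩, h3, h j (by omega)⟩
  · rintro ⟨⟨-, h4⟩, -, h5⟩ i hi
    rcases Nat.lt_succ_iff_lt_or_eq.1 hi with hi | rfl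
    · exact (h4 i hi).2
    · exact h5

lemma measurableSet_nextEvent {C : Set Ω} {u : ℕ} (hC : MeasurableSet[past n arr err (u + 1)] C)
    (j : ℕ) : MeasurableSet[past n arr err (u + 1 + j + 1)] (nextEvent n arr C u j) := by
  rw [nextEvent_eq (err := err)]
  exact measurableSet_run_then hC _ _ j

lemma measurableSet_ackedEvent {C : Set Ω} {u : ℕ}
    (hC : MeasurableSet[past n arr err (u + 1)] C) (j : ℕ) :
    MeasurableSet[past n arr err (u + 1 + j + 1)] (ackedEvent n arr err C u j) := by
  rw [ackedEvent_eq]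
  exact @MeasurableSet.diff _ (past n arr err (u + 1 + j + 1)) _ _ (measurableSet_nextEvent hC j)
    (measurableSet_run_then hC _ _ j)

namespace IsLink

lemma prob_nextEvent (h : IsLink P lam eps arr err) {C : Set Ω} {u : ℕ}
    (hC : MeasurableSet[past n arr err (u + 1)] C) (j : ℕ) :
    P.real (nextEvent n arr C u j) =
      P.real C * (((1 - lam) ^ n) ^ j * (1 - (1 - lam) ^ n)) := by
  rw [nextEvent_eq (err := err)]
  exact measureReal_run_then h.arr_meas h.err_meas h.indep hC h.prob_idle h.prob_arrival j

lemma prob_ackedEvent (h : IsLink P lam eps arr err) {C : Set Ω} {u : ℕ}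
    (hC : MeasurableSet[past n arr err (u + 1)] C) (j : ℕ) :
    P.real (ackedEvent n arr err C u j) =
      P.real C * (((1 - lam) ^ n) ^ j * (1 - (1 - lam) ^ n) -
        ((1 - lam) ^ n * eps) ^ j * (eps - (1 - lam) ^ n * eps)) := by
  rw [ackedEvent_eq, measureReal_sdiff _ (h.past_le _ _ (measurableSet_run_then hC _ _ j)),
    h.prob_nextEvent hC,
    measureReal_run_then h.arr_meas h.err_meas h.indep hC h.prob_idle_nack h.prob_arrival_nack,
    ← mul_sub]
  rw [nextEvent_eq (err := err)]
  rintro ω ⟨⟨h1, h2⟩, h3⟩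
  exact ⟨⟨h1, fun i hi => (h2 i hi).1⟩, h3.1⟩

end IsLink

/-- The stamp of the `j`th packet is known at the end of its frame. -/
lemma measurableSet_isArrival_past (j u : ℕ) :
    MeasurableSet[past n arr err (u + 1)] {ω | IsArrival n (fun c => arr c ω) j u} :=
  measurableSet_isArrival (err := err) (fun _ ht => measurable_state_past (by omega)) j

lemma measurableSet_arrivalAfter_past (m u : ℕ) :
    MeasurableSet[past n arr err (u + 1)]
      {ω | ArrivalAfter n (fun c => arr c ω) (fun t => err t ω) m u} :=
  measurableSet_arrivalAfter (fun _ ht => measurable_state_past (by omega)) m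

lemma IsArrival.unique {a : ℕ → Bool} {j u u' : ℕ} (h : IsArrival n a j u)
    (h' : IsArrival n a j u') : u = u' :=
  h.arrivalStamp_eq.symm.trans h'.arrivalStamp_eq

lemma eq_of_first {p : ℕ → Prop} {j j' : ℕ} (h1 : ∀ i < j, ¬ p i) (h2 : p j)
    (h1' : ∀ i < j', ¬ p i) (h2' : p j') : j = j' := by
  rcases lt_trichotomy j j' with hlt | heq | hlt
  · exact absurd h2 (h1' j hlt)
  · exact heq
  · exact absurd h2' (h1 j' hlt)

end Law

end PeakAge

namespace PeakAge

/-! ### Expectations as series over arrival frames and marks -/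

section Expectations

set_option linter.unusedSectionVars false

variable {Ω : Type*} [mΩ : MeasurableSpace Ω] {P : Measure Ω} [IsProbabilityMeasure P]
  {n : ℕ} {lam eps : ℝ} {arr err : ℕ → Ω → Bool}

/-- `P (T = j + 1)`. -/
noncomputable def wT (r : ℝ) (j : ℕ) : ℝ := r ^ j * (1 - r)

/-- `P (T = j + 1, not preempted)`. -/
noncomputable def wT0 (r eps : ℝ) (j : ℕ) : ℝ :=
  r ^ j * (1 - r) - (r * eps) ^ j * (eps - r * eps)

/-- `P (service = j + 1, not preempted)`. -/
noncomputable def wH0 (r eps : ℝ) (j : ℕ) : ℝ := (r * eps) ^ j * (1 - eps)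

lemma hasSum_geometric_pgf {r c : ℝ} (hr0 : 0 ≤ r) (hr1 : r < 1) {s : ℂ} (hs : ‖s‖ ≤ 1) :
    HasSum (fun j : ℕ => ((r ^ j * c : ℝ) : ℂ) * s ^ (j + 1)) (c * s / (1 - r * s)) := by
  -- Strict even on the unit circle, since `r < 1`.
  have hrs : ‖(r : ℂ) * s‖ < 1 := by
    rw [norm_mul, Complex.norm_real, Real.norm_of_nonneg hr0]
    exact lt_of_le_of_lt (mul_le_of_le_one_right hr0 hs) hr1
  have h : (fun j : ℕ => ((r ^ j * c : ℝ) : ℂ) * s ^ (j + 1)) =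
      fun j : ℕ => (c : ℂ) * s * ((r : ℂ) * s) ^ j := by
    funext j
    push_cast
    rw [mul_pow]
    ring
  rw [h, div_eq_mul_inv]
  exact (hasSum_geometric_of_norm_lt_one hrs).mul_left _

lemma summable_wH0 {r eps : ℝ} (hr0 : 0 ≤ r) (hr1 : r < 1) (h0 : 0 ≤ eps) (h1 : eps < 1) :
    Summable (wH0 r eps) :=
  (summable_geometric_of_lt_one (mul_nonneg hr0 h0)
    (mul_lt_one_of_nonneg_of_lt_one_left hr0 hr1 h1.le)).mul_right _

lemma summable_wT {r : ℝ} (hr0 : 0 ≤ r) (hr1 : r < 1) : Summable (wT r) :=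
  (summable_geometric_of_lt_one hr0 hr1).mul_right _

lemma summable_wT0 {r eps : ℝ} (hr0 : 0 ≤ r) (hr1 : r < 1) (h0 : 0 ≤ eps) (h1 : eps < 1) :
    Summable (wT0 r eps) :=
  (summable_wT hr0 hr1).sub ((summable_geometric_of_lt_one (mul_nonneg hr0 h0)
    (mul_lt_one_of_nonneg_of_lt_one_left hr0 hr1 h1.le)).mul_right _)

lemma hasSum_wT {r : ℝ} (hr0 : 0 ≤ r) (hr1 : r < 1) {s : ℂ} (hs : ‖s‖ ≤ 1) :
    HasSum (fun j : ℕ => (wT r j : ℂ) * s ^ (j + 1)) ((1 - r) * s / (1 - r * s)) := by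
  have := hasSum_geometric_pgf (c := 1 - r) hr0 hr1 hs
  push_cast at this
  simpa [wT] using this

lemma hasSum_wH0 {r eps : ℝ} (hr0 : 0 ≤ r) (hr1 : r < 1) (h0 : 0 ≤ eps) (h1 : eps < 1)
    {s : ℂ} (hs : ‖s‖ ≤ 1) :
    HasSum (fun j : ℕ => (wH0 r eps j : ℂ) * s ^ (j + 1))
      ((1 - eps) * s / (1 - r * eps * s)) := by
  have := hasSum_geometric_pgf (c := 1 - eps) (mul_nonneg hr0 h0)
    (mul_lt_one_of_nonneg_of_lt_one_left hr0 hr1 h1.le) hs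
  push_cast at this
  simpa [wH0] using this

lemma hasSum_wT0 {r eps : ℝ} (hr0 : 0 ≤ r) (hr1 : r < 1) (h0 : 0 ≤ eps) (h1 : eps < 1)
    {s : ℂ} (hs : ‖s‖ ≤ 1) :
    HasSum (fun j : ℕ => (wT0 r eps j : ℂ) * s ^ (j + 1))
      ((1 - r) * s / (1 - r * s) - (eps - r * eps) * s / (1 - r * eps * s)) := by
  have := (hasSum_wT hr0 hr1 hs).sub (hasSum_geometric_pgf (c := eps - r * eps)
    (mul_nonneg hr0 h0) (mul_lt_one_of_nonneg_of_lt_one_left hr0 hr1 h1.le) hs)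
  push_cast at this
  simpa [wT, wT0, sub_mul] using this

namespace IsLink

lemma integral_interarrival_aux (h : IsLink P lam eps arr err) (hn : 1 ≤ n) (j : ℕ)
    {f : ℕ → ℂ} (hf : ∀ k, ‖f k‖ ≤ 1) :
    ∫ ω, f (interarrival n (fun c => arr c ω) j) ∂P =
      ((∑' u, P.real {ω | IsArrival n (fun c => arr c ω) j u} : ℝ) : ℂ) *
        ∑' k, (wT ((1 - lam) ^ n) k : ℂ) * f (k + 1) := by
  rw [← setIntegral_univ]
  refine setIntegral_of_renewal (P := P)
    (E := fun u k => nextEvent n arr {ω | IsArrival n (fun c => arr c ω) j u} u k)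
    (fun u k => h.past_le _ _ (measurableSet_nextEvent (measurableSet_isArrival_past j u) k))
    ?_ ?_ (summable_wT h.pow_nonneg (h.pow_lt_one hn)) (i₀ := 0) ?_
    (fun u k => h.prob_nextEvent (measurableSet_isArrival_past j u) k) ?_ hf
  · rintro ω u k u' k' ⟨h1, h2, h3⟩ ⟨h1', h2', h3'⟩
    obtain rfl := IsArrival.unique h1 h1'
    exact ⟨rfl, eq_of_first h2 h3 h2' h3'⟩
  · filter_upwards [h.ae_recurrent hn] with ω hr
    simp only [Set.mem_univ, true_iff]
    obtain ⟨k, hk, hlt⟩ := exists_least_ge hr.arrival (arrivalStamp n (fun c => arr c ω) j + 1)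
    exact ⟨_, k, hr.isArrival_iff.2 rfl, hlt, hk⟩
  · have := h.pow_lt_one hn
    simp only [wT, pow_zero, one_mul]
    linarith
  · refine ae_of_all _ fun ω u k hω => ?_
    exact IsArrival.interarrival_eq hω.1 hω.2.1 hω.2.2

/-- Normalization: the constant test function, written `1 ^ k` to match the generating function at
`s = 1`, gives total mass 1 on both sides. -/
lemma tsum_prob_isArrival (h : IsLink P lam eps arr err) (hn : 1 ≤ n) (j : ℕ) :
    ∑' u, P.real {ω | IsArrival n (fun c => arr c ω) j u} = 1 := by
  have h1 := h.integral_interarrival_aux hn j (f := fun k => 1 ^ k) (by simp)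
  rw [(hasSum_wT h.pow_nonneg (h.pow_lt_one hn) (s := 1) (by simp)).tsum_eq] at h1
  have : (1 : ℂ) - ((1 - lam) ^ n : ℝ) ≠ 0 := by
    rw [← Complex.ofReal_one, ← Complex.ofReal_sub, Complex.ofReal_ne_zero]
    linarith [h.pow_lt_one hn]
  rw [mul_one, mul_one, div_self this] at h1
  simp only [one_pow, integral_const, probReal_univ, one_smul, mul_one] at h1
  exact_mod_cast h1.symm

lemma integral_interarrival (h : IsLink P lam eps arr err) (hn : 1 ≤ n) (j : ℕ)
    {f : ℕ → ℂ} (hf : ∀ k, ‖f k‖ ≤ 1) :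
    ∫ ω, f (interarrival n (fun c => arr c ω) j) ∂P =
      ∑' k, (wT ((1 - lam) ^ n) k : ℂ) * f (k + 1) := by
  rw [h.integral_interarrival_aux hn j hf, h.tsum_prob_isArrival hn, Complex.ofReal_one, one_mul]

lemma setIntegral_interarrival (h : IsLink P lam eps arr err) (hn : 1 ≤ n) (j : ℕ)
    {f : ℕ → ℂ} (hf : ∀ k, ‖f k‖ ≤ 1) :
    ∫ ω in {ω | Delivered n (fun c => arr c ω) (fun t => err t ω)
        (arrivalStamp n (fun c => arr c ω) j)}, f (interarrival n (fun c => arr c ω) j) ∂P =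
      ∑' k, (wT0 ((1 - lam) ^ n) eps k : ℂ) * f (k + 1) := by
  have key := setIntegral_of_renewal (P := P)
    (S := {ω | Delivered n (fun c => arr c ω) (fun t => err t ω)
        (arrivalStamp n (fun c => arr c ω) j)})
    (C := fun u => {ω | IsArrival n (fun c => arr c ω) j u})
    (E := fun u k => ackedEvent n arr err {ω | IsArrival n (fun c => arr c ω) j u} u k)
    (X := fun ω => interarrival n (fun c => arr c ω) j) (x := fun k => k + 1)
    (fun u k => h.past_le _ _ (measurableSet_ackedEvent (measurableSet_isArrival_past j u) k))
    ?_ ?_ (summable_wT0 h.pow_nonneg (h.pow_lt_one hn) h.eps_nonneg h.eps_lt) (i₀ := 0) ?_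
    (fun u k => h.prob_ackedEvent (measurableSet_isArrival_past j u) k) ?_ hf
  · rw [key, h.tsum_prob_isArrival hn, Complex.ofReal_one, one_mul]
  · rintro ω u k u' k' ⟨⟨h1, h2, h3⟩, -⟩ ⟨⟨h1', h2', h3'⟩, -⟩
    obtain rfl := IsArrival.unique h1 h1'
    exact ⟨rfl, eq_of_first h2 h3 h2' h3'⟩
  · filter_upwards [h.ae_recurrent hn] with ω hr
    constructor
    · intro hω
      have hu := hr.isArrival_iff (j := j).2 rfl
      obtain ⟨k, hk, hlt⟩ := exists_least_ge hr.arrival (arrivalStamp n (fun c => arr c ω) j + 1)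
      exact ⟨_, k, ⟨hu, hlt, hk⟩, (delivered_iff_of_next_arrival_add hu.1 hlt hk).1 hω⟩
    · rintro ⟨u, k, ⟨h1, h2, h3⟩, h4⟩
      have := (delivered_iff_of_next_arrival_add (e := fun t => err t ω) h1.1 h2 h3).2 h4
      rwa [← IsArrival.arrivalStamp_eq h1] at this
  · have h1 := h.pow_lt_one hn
    have h2 := h.eps_lt
    simp only [wT0, pow_zero, one_mul]
    nlinarith [mul_pos (sub_pos.2 h1) (sub_pos.2 h2)]
  · refine ae_of_all _ fun ω u k hω => ?_
    exact IsArrival.interarrival_eq hω.1.1 hω.1.2.1 hω.1.2.2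

lemma setIntegral_service (h : IsLink P lam eps arr err) (hn : 1 ≤ n) (j : ℕ)
    {f : ℕ → ℂ} (hf : ∀ k, ‖f k‖ ≤ 1) :
    ∫ ω in {ω | Delivered n (fun c => arr c ω) (fun t => err t ω)
        (arrivalStamp n (fun c => arr c ω) j)},
        f (service n (fun c => arr c ω) (fun t => err t ω)
          (arrivalStamp n (fun c => arr c ω) j)) ∂P =
      ∑' k, (wH0 ((1 - lam) ^ n) eps k : ℂ) * f (k + 1) := by
  have hE : ∀ (u k : ℕ) (ω : Ω),
      ω ∈ (({ω | IsArrival n (fun c => arr c ω) j u} ∩ {ω | ∀ i < k,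
        state n arr err (u + 1 + i) ω ∈ {z : Bool × Bool | z.1 = false ∧ z.2 = true}}) ∩
        {ω | state n arr err (u + 1 + k) ω ∈ {z : Bool × Bool | z.2 = false}}) ↔
      IsArrival n (fun c => arr c ω) j u ∧
        DeliveredAt n (fun c => arr c ω) (fun t => err t ω) u (u + 1 + k) := by
    intro u k ω
    simp only [Set.mem_inter_iff, Set.mem_ofPred_eq, state_fst_false, state_snd, and_assoc]
    exact and_congr_right fun hu => (deliveredAt_add_iff (e := fun t => err t ω) hu.1).symm
  have key := setIntegral_of_renewal (P := P)
    (S := {ω | Delivered n (fun c => arr c ω) (fun t => err t ω)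
        (arrivalStamp n (fun c => arr c ω) j)})
    (C := fun u => {ω | IsArrival n (fun c => arr c ω) j u})
    (E := fun u k => ({ω | IsArrival n (fun c => arr c ω) j u} ∩ {ω | ∀ i < k,
        state n arr err (u + 1 + i) ω ∈ {z : Bool × Bool | z.1 = false ∧ z.2 = true}}) ∩
        {ω | state n arr err (u + 1 + k) ω ∈ {z : Bool × Bool | z.2 = false}})
    (X := fun ω => service n (fun c => arr c ω) (fun t => err t ω)
          (arrivalStamp n (fun c => arr c ω) j)) (x := fun k => k + 1)
    (fun u k => h.past_le _ _ (measurableSet_run_then (measurableSet_isArrival_past j u) _ _ k))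
    ?_ ?_ (summable_wH0 h.pow_nonneg (h.pow_lt_one hn) h.eps_nonneg h.eps_lt) (i₀ := 0) ?_
    (fun u k => measureReal_run_then h.arr_meas h.err_meas h.indep
      (measurableSet_isArrival_past j u) h.prob_idle_nack h.prob_ack k) ?_ hf
  · rw [key, h.tsum_prob_isArrival hn, Complex.ofReal_one, one_mul]
  · intro ω u k u' k' h1 h2
    rw [hE] at h1 h2
    obtain rfl := IsArrival.unique h1.1 h2.1
    have := h1.2.unique h2.2
    exact ⟨rfl, by omega⟩
  · filter_upwards [h.ae_recurrent hn] with ω hr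
    refine Iff.trans ?_ (exists₂_congr fun u k => hE u k ω).symm
    constructor
    · rintro ⟨t, ht⟩
      have := ht.lt
      refine ⟨_, t - (arrivalStamp n (fun c => arr c ω) j + 1), hr.isArrival_iff.2 rfl, ?_⟩
      rwa [Nat.add_sub_cancel' this]
    · rintro ⟨u, k, h1, h2⟩
      rw [← IsArrival.arrivalStamp_eq h1] at h2
      exact ⟨_, h2⟩
  · simp only [wH0, pow_zero, one_mul]
    linarith [h.eps_lt]
  · refine ae_of_all _ fun ω u k hω => ?_
    rw [hE] at hω
    rw [hω.1.arrivalStamp_eq, hω.2.service_eq]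
    omega

/-- The sample points at which `PeakEvent` holds with marks `q`. -/
def _root_.PeakAge.peakSet (n : ℕ) (arr err : ℕ → Ω → Bool) (m u : ℕ) (q : ℕ × ℕ) : Set Ω :=
  {ω | PeakEvent n (fun c => arr c ω) (fun t => err t ω) m u q.1 q.2}

/-- Puts the event in chronological order: first what is known once the next arrival frame has
ended, then a run of NACKs closed by an ACK. In this form independence of frames applies. -/
lemma _root_.PeakAge.peakSet_eq (m u : ℕ) (q : ℕ × ℕ) : peakSet n arr err m u q =
    (ackedEvent n arr err {ω | ArrivalAfter n (fun c => arr c ω) (fun t => err t ω) m u} u q.1 ∩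
      {ω | ∀ i < q.2, state n arr err (u + 1 + q.1 + 1 + i) ω ∈ {z : Bool × Bool | z.2 = true}}) ∩
      {ω | state n arr err (u + 1 + q.1 + 1 + q.2) ω ∈ {z : Bool × Bool | z.2 = false}} := by
  ext ω
  constructor
  · rintro ⟨h1, h2, h3, h4, h5, h6, h7⟩
    exact ⟨⟨⟨⟨⟨h1, h2⟩, h3, h4⟩, h5⟩, h6⟩, h7⟩
  · rintro ⟨⟨⟨⟨⟨h1, h2⟩, h3, h4⟩, h5⟩, h6⟩, h7⟩
    exact ⟨h1, h2, h3, h4, h5, h6, h7⟩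

lemma measurableSet_peakSet (h : IsLink P lam eps arr err) (m u : ℕ) (q : ℕ × ℕ) :
    MeasurableSet (peakSet n arr err m u q) := by
  rw [peakSet_eq]
  exact h.past_le _ _ (measurableSet_run_then
    (measurableSet_ackedEvent (measurableSet_arrivalAfter_past m u) q.1) _ _ q.2)

lemma summable_peak_weights (h : IsLink P lam eps arr err) (hn : 1 ≤ n) :
    Summable fun q : ℕ × ℕ => wT0 ((1 - lam) ^ n) eps q.1 * (eps ^ q.2 * (1 - eps)) :=
  summable_mul_of_summable_norm
    (summable_wT0 h.pow_nonneg (h.pow_lt_one hn) h.eps_nonneg h.eps_lt).norm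
    ((summable_geometric_of_lt_one h.eps_nonneg h.eps_lt).mul_right (1 - eps)).norm

/-- The conditioning event says only that a packet arrives in frame `u` after `m` deliveries, not
that it will be delivered: it must be known by the end of frame `u`. Delivery is part of the mark
weight `wT0`. -/
lemma integral_peakAge_aux (h : IsLink P lam eps arr err) (hn : 1 ≤ n) (m : ℕ)
    {f : ℕ → ℂ} (hf : ∀ k, ‖f k‖ ≤ 1) :
    ∫ ω, f (peakAge n (fun c => arr c ω) (fun t => err t ω) (m + 1)) ∂P =
      ((∑' u, P.real {ω | ArrivalAfter n (fun c => arr c ω) (fun t => err t ω) m u} : ℝ) : ℂ) *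
        ∑' q : ℕ × ℕ, ((wT0 ((1 - lam) ^ n) eps q.1 * (eps ^ q.2 * (1 - eps)) : ℝ) : ℂ) *
          f ((q.1 + 1) + (q.2 + 1)) := by
  rw [← setIntegral_univ]
  refine setIntegral_of_renewal (P := P) (E := peakSet n arr err m)
    (h.measurableSet_peakSet m) ?_ ?_ (h.summable_peak_weights hn) (i₀ := (0, 0)) ?_
    (fun u q => ?_) ?_ hf
  · intro ω u q u' q' h1 h2
    obtain ⟨hu, h3, h4⟩ := PeakEvent.unique h1 h2
    exact ⟨hu, Prod.ext h3 h4⟩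
  · filter_upwards [h.ae_recurrent hn] with ω hr
    simp only [Set.mem_univ, true_iff]
    obtain ⟨u, j, l, hp⟩ := hr.exists_peakEvent m
    exact ⟨u, (j, l), hp⟩
  · have h1 := h.pow_lt_one hn
    have h2 := h.eps_lt
    simp only [wT0, pow_zero, one_mul]
    refine (mul_pos ?_ (sub_pos.2 h2)).ne'
    nlinarith [mul_pos (sub_pos.2 h1) (sub_pos.2 h2)]
  · rw [peakSet_eq, measureReal_run_then h.arr_meas h.err_meas h.indep
      (measurableSet_ackedEvent (measurableSet_arrivalAfter_past m u) q.1) h.prob_nack h.prob_ack,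
      h.prob_ackedEvent (measurableSet_arrivalAfter_past m u), mul_assoc]
    rfl
  · filter_upwards [h.ae_recurrent hn] with ω hr u q hq
    exact PeakEvent.peakAge_eq hr hq

lemma aemeasurable_peakAge (h : IsLink P lam eps arr err) (hn : 1 ≤ n) (m : ℕ) :
    AEMeasurable (fun ω => peakAge n (fun c => arr c ω) (fun t => err t ω) m) P := by
  cases m with
  | succ m =>
    refine aemeasurable_of_partition (E := fun q : ℕ × ℕ × ℕ => peakSet n arr err m q.1 q.2)
      (x := fun q => (q.2.1 + 1) + (q.2.2 + 1)) (fun q => h.measurableSet_peakSet m _ _) ?_ ?_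
    · filter_upwards [h.ae_recurrent hn] with ω hr
      obtain ⟨u, j, l, hp⟩ := hr.exists_peakEvent m
      exact ⟨(u, j, l), hp⟩
    · filter_upwards [h.ae_recurrent hn] with ω hr q hq
      exact PeakEvent.peakAge_eq hr hq
  | zero =>
    have hE : ∀ (q : ℕ × ℕ) (ω : Ω), ω ∈
        (({ω | ArrivalAfter n (fun c => arr c ω) (fun t => err t ω) 0 q.1} ∩ {ω | ∀ i < q.2,
          state n arr err (q.1 + 1 + i) ω ∈ {z : Bool × Bool | z.1 = false ∧ z.2 = true}}) ∩
          {ω | state n arr err (q.1 + 1 + q.2) ω ∈ {z : Bool × Bool | z.2 = false}}) ↔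
        ArrivalAfter n (fun c => arr c ω) (fun t => err t ω) 0 q.1 ∧
          DeliveredAt n (fun c => arr c ω) (fun t => err t ω) q.1 (q.1 + 1 + q.2) := by
      intro q ω
      simp only [Set.mem_inter_iff, Set.mem_ofPred_eq, state_fst_false, state_snd, and_assoc]
      exact and_congr_right fun hu => (deliveredAt_add_iff (e := fun t => err t ω) hu.1).symm
    refine aemeasurable_of_partition (x := fun q : ℕ × ℕ => q.2 + 1)
      (fun q => h.past_le _ _ (measurableSet_run_then (measurableSet_arrivalAfter_past (n := n) 0 q.1)
        {z : Bool × Bool | z.1 = false ∧ z.2 = true} {z : Bool × Bool | z.2 = false} q.2)) ?_ ?_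
    · filter_upwards [h.ae_recurrent hn] with ω hr
      obtain ⟨u, k, hp⟩ := hr.exists_arrivalAfter 0
      exact ⟨(u, k), (hE _ _).2 hp⟩
    · filter_upwards [h.ae_recurrent hn] with ω hr q hq
      obtain ⟨h1, h2⟩ := (hE _ _).1 hq
      exact h1.peakAge_zero hr h2

end IsLink

end Expectations

end PeakAge

namespace PeakAge

/-! ### Closed forms of the generating functions and the law of the peak age -/

section Main

variable {Ω : Type*} [mΩ : MeasurableSpace Ω] {P : Measure Ω}
  {n : ℕ} {lam eps : ℝ} {arr err : ℕ → Ω → Bool}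

lemma pgf_cond (S : Set Ω) (X : Ω → ℕ) (s : ℂ) :
    pgf (cond P S) X s = (∫ ω in S, s ^ X ω ∂P) / (P.real S : ℂ) := by
  rw [pgf, ProbabilityTheory.cond, integral_smul_measure, ENNReal.toReal_inv, Complex.real_smul, Complex.ofReal_inv,
    div_eq_inv_mul]
  rfl

variable [IsProbabilityMeasure P]

lemma one_sub_mul_ne_zero {r : ℝ} (hr0 : 0 ≤ r) (hr1 : r < 1) {s : ℂ} (hs : ‖s‖ ≤ 1) :
    (1 : ℂ) - r * s ≠ 0 := by
  intro h
  have h1 : ‖(r : ℂ) * s‖ = 1 := by rw [← sub_eq_zero.1 h, norm_one]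
  rw [norm_mul, Complex.norm_real, Real.norm_of_nonneg hr0] at h1
  have := mul_le_of_le_one_right hr0 hs
  linarith

lemma GH0_eq (n : ℕ) (lam eps : ℝ) (s : ℂ) : GH0 n lam eps s =
    (1 - ((1 - lam) ^ n : ℝ) * eps) * s / (1 - ((1 - lam) ^ n : ℝ) * eps * s) := by
  rw [GH0]
  push_cast
  ring_nf

lemma GT_eq (n : ℕ) (lam : ℝ) (s : ℂ) : GT n lam s =
    (1 - ((1 - lam) ^ n : ℝ)) * s / (1 - ((1 - lam) ^ n : ℝ) * s) := by
  rw [GT]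
  push_cast
  rfl

lemma probOK_eq (n : ℕ) (lam eps : ℝ) :
    probOK n lam eps = (1 - eps) / (1 - (1 - lam) ^ n * eps) := by
  rw [probOK, mul_comm eps]

namespace IsLink

lemma one_sub_pos (h : IsLink P lam eps arr err) (hn : 1 ≤ n) : 0 < 1 - (1 - lam) ^ n * eps := by
  have := mul_lt_one_of_nonneg_of_lt_one_left h.pow_nonneg (h.pow_lt_one hn) h.eps_lt.le
  linarith

lemma probOK_pos (h : IsLink P lam eps arr err) (hn : 1 ≤ n) : 0 < probOK n lam eps := by
  rw [probOK_eq]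
  exact div_pos (by linarith [h.eps_lt]) (h.one_sub_pos hn)

lemma tsum_wH0 (h : IsLink P lam eps arr err) (hn : 1 ≤ n) {s : ℂ} (hs : ‖s‖ ≤ 1) :
    ∑' k, (wH0 ((1 - lam) ^ n) eps k : ℂ) * s ^ (k + 1) = probOK n lam eps * GH0 n lam eps s := by
  rw [(hasSum_wH0 h.pow_nonneg (h.pow_lt_one hn) h.eps_nonneg h.eps_lt hs).tsum_eq, GH0_eq,
    probOK_eq]
  have h1 : (1 : ℂ) - ((1 - lam) ^ n : ℝ) * eps ≠ 0 := by exact_mod_cast (h.one_sub_pos hn).ne'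
  rw [Complex.ofReal_div, Complex.ofReal_sub, Complex.ofReal_sub, Complex.ofReal_mul,
    Complex.ofReal_one]
  generalize (((1 - lam) ^ n : ℝ) : ℂ) * (eps : ℂ) = b at *
  field_simp

lemma tsum_wT0 (h : IsLink P lam eps arr err) (hn : 1 ≤ n) {s : ℂ} (hs : ‖s‖ ≤ 1) :
    ∑' k, (wT0 ((1 - lam) ^ n) eps k : ℂ) * s ^ (k + 1) = probOK n lam eps * GT0 n lam eps s := by
  have hp : (probOK n lam eps : ℂ) ≠ 0 := by exact_mod_cast (h.probOK_pos hn).ne'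
  rw [(hasSum_wT0 h.pow_nonneg (h.pow_lt_one hn) h.eps_nonneg h.eps_lt hs).tsum_eq, GT0,
    mul_div_cancel₀ _ hp, GH0_eq, GT_eq, probOK_eq]
  have h1 : (1 : ℂ) - ((1 - lam) ^ n : ℝ) * eps ≠ 0 := by exact_mod_cast (h.one_sub_pos hn).ne'
  rw [Complex.ofReal_div, Complex.ofReal_sub, Complex.ofReal_sub, Complex.ofReal_mul,
    Complex.ofReal_one]
  congr 1
  -- With `r = (1 - lam) ^ n`, `1 - p = (eps - r * eps) / (1 - r * eps)`; its denominator cancels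
  -- the numerator factor of `GH0`.
  rw [one_sub_div h1]
  generalize (((1 - lam) ^ n : ℝ) : ℂ) * (eps : ℂ) = b at *
  field_simp
  ring

lemma pgf_interarrival (h : IsLink P lam eps arr err) (hn : 1 ≤ n) (j : ℕ) {s : ℂ}
    (hs : ‖s‖ ≤ 1) : pgf P (fun ω => interarrival n (fun c => arr c ω) j) s = GT n lam s := by
  rw [pgf, h.integral_interarrival hn j (f := fun k => s ^ k)
    (fun k => by rw [norm_pow]; exact pow_le_one₀ (norm_nonneg _) hs),
    (hasSum_wT h.pow_nonneg (h.pow_lt_one hn) hs).tsum_eq, GT_eq]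

lemma probReal_delivered (h : IsLink P lam eps arr err) (hn : 1 ≤ n) (j : ℕ) :
    P.real {ω | Delivered n (fun c => arr c ω) (fun t => err t ω)
        (arrivalStamp n (fun c => arr c ω) j)} = probOK n lam eps := by
  have key := h.setIntegral_service hn j (f := fun k => 1 ^ k) (by simp)
  rw [h.tsum_wH0 hn (by simp), GH0_eq] at key
  have h1 : (1 : ℂ) - ((1 - lam) ^ n : ℝ) * eps ≠ 0 := by exact_mod_cast (h.one_sub_pos hn).ne'
  rw [mul_one, mul_one, div_self h1] at key
  simp only [one_pow, mul_one, setIntegral_const, Complex.real_smul] at key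
  exact_mod_cast key

lemma pgf_service (h : IsLink P lam eps arr err) (hn : 1 ≤ n) (j : ℕ) {s : ℂ} (hs : ‖s‖ ≤ 1) :
    pgf (cond P {ω | Delivered n (fun c => arr c ω) (fun t => err t ω)
          (arrivalStamp n (fun c => arr c ω) j)})
        (fun ω => service n (fun c => arr c ω) (fun t => err t ω)
          (arrivalStamp n (fun c => arr c ω) j)) s = GH0 n lam eps s := by
  have hp : (probOK n lam eps : ℂ) ≠ 0 := by exact_mod_cast (h.probOK_pos hn).ne'
  rw [pgf_cond, h.probReal_delivered hn, h.setIntegral_service hn j (f := fun k => s ^ k)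
    (fun k => by rw [norm_pow]; exact pow_le_one₀ (norm_nonneg _) hs), h.tsum_wH0 hn hs,
    mul_div_cancel_left₀ _ hp]

lemma pgf_cond_interarrival (h : IsLink P lam eps arr err) (hn : 1 ≤ n) (j : ℕ) {s : ℂ}
    (hs : ‖s‖ ≤ 1) :
    pgf (cond P {ω | Delivered n (fun c => arr c ω) (fun t => err t ω)
          (arrivalStamp n (fun c => arr c ω) j)})
        (fun ω => interarrival n (fun c => arr c ω) j) s = GT0 n lam eps s := by
  have hp : (probOK n lam eps : ℂ) ≠ 0 := by exact_mod_cast (h.probOK_pos hn).ne'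
  rw [pgf_cond, h.probReal_delivered hn, h.setIntegral_interarrival hn j (f := fun k => s ^ k)
    (fun k => by rw [norm_pow]; exact pow_le_one₀ (norm_nonneg _) hs), h.tsum_wT0 hn hs,
    mul_div_cancel_left₀ _ hp]

lemma tsum_peak_weights (h : IsLink P lam eps arr err) (hn : 1 ≤ n) {s : ℂ} (hs : ‖s‖ ≤ 1) :
    ∑' q : ℕ × ℕ, ((wT0 ((1 - lam) ^ n) eps q.1 * (eps ^ q.2 * (1 - eps)) : ℝ) : ℂ) *
        s ^ ((q.1 + 1) + (q.2 + 1)) =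
      probOK n lam eps * (GT0 n lam eps s * (probOK n lam eps * GH0 n lam eps s /
        (1 - (1 - (probOK n lam eps : ℂ)) * GH0 n lam eps s))) := by
  have hack := hasSum_geometric_pgf (c := 1 - eps) h.eps_nonneg h.eps_lt hs
  have hT := hasSum_wT0 h.pow_nonneg (h.pow_lt_one hn) h.eps_nonneg h.eps_lt hs
  have hfac : ∀ q : ℕ × ℕ, ((wT0 ((1 - lam) ^ n) eps q.1 * (eps ^ q.2 * (1 - eps)) : ℝ) : ℂ) *
      s ^ ((q.1 + 1) + (q.2 + 1)) = ((wT0 ((1 - lam) ^ n) eps q.1 : ℂ) * s ^ (q.1 + 1)) *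
        (((eps ^ q.2 * (1 - eps) : ℝ) : ℂ) * s ^ (q.2 + 1)) := fun q => by
    rw [pow_add, Complex.ofReal_mul]
    ring
  rw [tsum_congr hfac, ← tsum_mul_tsum_of_summable_norm hT.summable.norm hack.summable.norm,
    h.tsum_wT0 hn hs, hack.tsum_eq, mul_assoc]
  congr 2
  have h1 : (1 : ℂ) - ((1 - lam) ^ n : ℝ) * eps ≠ 0 := by exact_mod_cast (h.one_sub_pos hn).ne'
  have h2 : (1 : ℂ) - eps * s ≠ 0 := one_sub_mul_ne_zero h.eps_nonneg h.eps_lt hs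
  have h3 : (1 : ℂ) - ((1 - lam) ^ n : ℝ) * eps * s ≠ 0 := by
    have := one_sub_mul_ne_zero (r := (1 - lam) ^ n * eps)
      (mul_nonneg h.pow_nonneg h.eps_nonneg) (by linarith [h.one_sub_pos hn]) hs
    rwa [Complex.ofReal_mul] at this
  rw [GH0_eq, probOK_eq, Complex.ofReal_div, Complex.ofReal_sub, Complex.ofReal_sub,
    Complex.ofReal_mul, Complex.ofReal_one, one_sub_div h1]
  generalize (((1 - lam) ^ n : ℝ) : ℂ) * (eps : ℂ) = b at *
  have h4 : (1 : ℂ) - (1 - b - (1 - eps)) / (1 - b) *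
      ((1 - b) * s / (1 - b * s)) = (1 - eps * s) / (1 - b * s) := by
    field_simp
    ring
  rw [h4]
  rw [mul_comm b s] at h3 ⊢
  field_simp

/-- The sum over `u` is the mean number of packets that arrive after exactly `m` deliveries, the
last of which is the delivered one. Its value 1/p follows from the constant test function, because
the mark weights sum to `p`. -/
lemma integral_peakAge (h : IsLink P lam eps arr err) (hn : 1 ≤ n) (m : ℕ)
    {f : ℕ → ℂ} (hf : ∀ k, ‖f k‖ ≤ 1) :
    ∫ ω, f (peakAge n (fun c => arr c ω) (fun t => err t ω) (m + 1)) ∂P =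
      (probOK n lam eps : ℂ)⁻¹ *
        ∑' q : ℕ × ℕ, ((wT0 ((1 - lam) ^ n) eps q.1 * (eps ^ q.2 * (1 - eps)) : ℝ) : ℂ) *
          f ((q.1 + 1) + (q.2 + 1)) := by
  have hp : (probOK n lam eps : ℂ) ≠ 0 := by exact_mod_cast (h.probOK_pos hn).ne'
  rw [h.integral_peakAge_aux hn m hf]
  congr 1
  have h1 := h.integral_peakAge_aux hn m (f := fun k => 1 ^ k) (by simp)
  have hG : GH0 n lam eps 1 = 1 := by
    have h1 : (1 : ℂ) - ((1 - lam) ^ n : ℝ) * eps ≠ 0 := by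
      exact_mod_cast (h.one_sub_pos hn).ne'
    rw [GH0_eq, mul_one, mul_one, div_self h1]
  have hT : GT n lam 1 = 1 := by
    have h1 : (1 : ℂ) - ((1 - lam) ^ n : ℝ) ≠ 0 := by
      exact_mod_cast (sub_pos.2 (h.pow_lt_one hn)).ne'
    rw [GT_eq, mul_one, mul_one, div_self h1]
  rw [h.tsum_peak_weights hn (by simp), GT0, hG, hT, mul_one, mul_one, sub_sub_cancel,
    div_self hp, mul_one, mul_one] at h1
  simp only [one_pow, integral_const, probReal_univ, one_smul] at h1
  exact eq_inv_of_mul_eq_one_left h1.symm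

/-- The right-hand side of `integral_peakAge` is free of `m`; indicators of singletons as test
functions turn this into equality of laws. -/
lemma map_peakAge_eq (h : IsLink P lam eps arr err) (hn : 1 ≤ n) (m : ℕ) :
    P.map (fun ω => peakAge n (fun c => arr c ω) (fun t => err t ω) (m + 1)) =
      P.map (fun ω => peakAge n (fun c => arr c ω) (fun t => err t ω) 1) := by
  have key : ∀ k m : ℕ,
      ((P.map fun ω => peakAge n (fun c => arr c ω) (fun t => err t ω) (m + 1)).real {k} : ℂ) =
      ∫ ω, (Set.indicator {k} (fun _ => (1 : ℂ)))
        (peakAge n (fun c => arr c ω) (fun t => err t ω) (m + 1)) ∂P := fun k m => by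
    rw [← integral_map (h.aemeasurable_peakAge hn _)
      (StronglyMeasurable.of_discrete).aestronglyMeasurable,
      integral_indicator (measurableSet_singleton k), setIntegral_const, Complex.real_smul,
      mul_one]
  have : IsProbabilityMeasure
      (P.map fun ω => peakAge n (fun c => arr c ω) (fun t => err t ω) (m + 1)) :=
    Measure.isProbabilityMeasure_map (h.aemeasurable_peakAge hn _)
  have : IsProbabilityMeasure
      (P.map fun ω => peakAge n (fun c => arr c ω) (fun t => err t ω) 1) :=
    Measure.isProbabilityMeasure_map (h.aemeasurable_peakAge hn _)
  refine ext_iff_measureReal_singleton.2 fun k => Complex.ofReal_injective ?_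
  have hb : ∀ i, ‖Set.indicator {k} (fun _ => (1 : ℂ)) i‖ ≤ 1 := fun i => by
    rw [Set.indicator_apply]
    split_ifs <;> simp
  rw [key k m, key k 0, h.integral_peakAge hn m hb, h.integral_peakAge hn 0 hb]

end IsLink

end Main

end PeakAge

theorem theorem2 {Ω : Type*} [MeasurableSpace Ω] (P : Measure Ω) [IsProbabilityMeasure P]
    (n : ℕ) (hn : 1 ≤ n) (lam eps : ℝ) (hlam0 : 0 < lam) (hlam1 : lam ≤ 1)
    (heps0 : 0 ≤ eps) (heps1 : eps < 1)
    -- `arr c`: a packet arrives in channel use `c`; `err t`: a transmission in frame `t` fails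
    (arr err : ℕ → Ω → Bool)
    (harr_meas : ∀ c, Measurable (arr c)) (herr_meas : ∀ t, Measurable (err t))
    (hindep : iIndepFun (Sum.elim arr err) P)
    (harr : ∀ c, P {ω | arr c ω = true} = ENNReal.ofReal lam)
    (herr : ∀ t, P {ω | err t ω = true} = ENNReal.ofReal eps) :
    -- the steady-state peak age exists, and its generating function is the stated one
    (∃ π : Measure ℕ, ∃ _ : IsProbabilityMeasure π,
      TendstoInDistribution
        (fun m ω => PeakAge.peakAge n (fun c => arr c ω) (fun t => err t ω) m)
        atTop (id : ℕ → ℕ) (fun _ => P) π ∧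
      ∀ s : ℂ, ‖s‖ ≤ 1 →
        PeakAge.pgf π id s =
          PeakAge.GT0 n lam eps s *
            ((PeakAge.probOK n lam eps : ℂ) * PeakAge.GH0 n lam eps s /
              (1 - (1 - (PeakAge.probOK n lam eps : ℂ)) * PeakAge.GH0 n lam eps s))) ∧
    -- the meaning of the factors, for the `j`th packet
    (∀ j : ℕ,
      -- `p` is the probability that the packet is not preempted
      P {ω | PeakAge.Delivered n (fun c => arr c ω) (fun t => err t ω)
          (PeakAge.arrivalStamp n (fun c => arr c ω) j)} =
        ENNReal.ofReal (PeakAge.probOK n lam eps) ∧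
      ∀ s : ℂ, ‖s‖ ≤ 1 →
        -- service time, given that the packet is not preempted
        PeakAge.pgf
            (cond P {ω | PeakAge.Delivered n (fun c => arr c ω) (fun t => err t ω)
              (PeakAge.arrivalStamp n (fun c => arr c ω) j)})
            (fun ω => PeakAge.service n (fun c => arr c ω) (fun t => err t ω)
              (PeakAge.arrivalStamp n (fun c => arr c ω) j)) s =
          PeakAge.GH0 n lam eps s ∧
        -- time to the next arrival, given that the packet is not preempted
        PeakAge.pgf
            (cond P {ω | PeakAge.Delivered n (fun c => arr c ω) (fun t => err t ω)
              (PeakAge.arrivalStamp n (fun c => arr c ω) j)})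
            (fun ω => PeakAge.interarrival n (fun c => arr c ω) j) s =
          PeakAge.GT0 n lam eps s ∧
        -- time between two arrivals
        PeakAge.pgf P (fun ω => PeakAge.interarrival n (fun c => arr c ω) j) s =
          PeakAge.GT n lam s) := by
  have h : PeakAge.IsLink P lam eps arr err :=
    ⟨hlam0, hlam1, heps0, heps1, harr_meas, herr_meas, hindep, harr, herr⟩
  have hA := h.aemeasurable_peakAge hn
  have hprob := Measure.isProbabilityMeasure_map (hA 1)
  refine ⟨⟨P.map fun ω => PeakAge.peakAge n (fun c => arr c ω) (fun t => err t ω) 1,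
    hprob, ⟨hA, aemeasurable_id, ?_⟩, fun s hs => ?_⟩,
    fun j => ⟨?_, fun s hs => ⟨h.pgf_service hn j hs, h.pgf_cond_interarrival hn j hs,
      h.pgf_interarrival hn j hs⟩⟩⟩
  -- The limit is the law of the peak age with index 1, attained at every index except possibly 0.
  · refine tendsto_const_nhds.congr' ?_
    filter_upwards [eventually_ge_atTop 1] with m hm
    obtain ⟨m, rfl⟩ := Nat.exists_eq_add_of_le' hm
    exact Subtype.ext (Measure.map_id.trans (h.map_peakAge_eq hn m).symm)
  · have hp : (PeakAge.probOK n lam eps : ℂ) ≠ 0 := by exact_mod_cast (h.probOK_pos hn).ne'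
    simp only [PeakAge.pgf, id]
    rw [integral_map (hA 1) (StronglyMeasurable.of_discrete).aestronglyMeasurable,
      h.integral_peakAge hn 0 (f := fun k => s ^ k)
        (fun k => by rw [norm_pow]; exact pow_le_one₀ (norm_nonneg _) hs),
      h.tsum_peak_weights hn hs, inv_mul_cancel_left₀ hp]
  · rw [← h.probReal_delivered hn j, ofReal_measureReal]
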